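/- Let $d,n>0$ be integers and let $k$ be a field. Let $C=B=\mathbb P^1_k$ and let $f:C\to B$ be a $k$-morphism of degree $d$ such that the function field extension $k(C)/k(B)$ is separable and the Galois group of its Galois closure is the full symmetric group $\mathfrak S_d$. Let $g=[G_0:\dots:G_n]:C\to(\mathbb P^n_k)^\vee$ be a rational normal curve of degree $n$, i.e. $G_0,\dots,G_n$ is a basis of the binary forms of degree $n$ over $k$; for a point $c$ of $C$ regard $g(c)$ as the linear form $\sum_i G_i(c)x_i$ on $\mathbb P^n$. Let $\mathcal X_h\subset B\times\mathbb P^n$ be the hypersurface, of bidegree $(n,d)$, whose equation is the norm along $f$ of $\sum_i G_ix_i$; if $f=[p:q]$ with $p,q$ coprime binary forms of degree $d$, this equation is the resultant of the binary forms $u_1p-u_0q$ and $\sum_i G_ix_i$, where $[u_0:u_1]$ are the coordinates on $B$. Thus the fibre of $\mathcal X_h$ over a geometric point $b$ with $f^{-1}(b)=\{c_1,\dots,c_d\}$ is the union of the hyperplanes $g(c_1),\dots,g(c_d)$. Let $\pi:\mathcal X_h\to B$ be the projection, $K=k(B)$, and $\mathcal X_{h,K}$ the generic fibre of $\pi$.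 A multi-section of $\pi$ is a closed subscheme $Z\subset\mathcal X_h$ that is finite and surjective over $B$; its degree is $\dim_K\Gamma(Z_K,\mathcal O_{Z_K})$, where $Z_K$ is the generic fibre of $Z\to B$. For a $K$-scheme $X$ of finite type put $M(K,X)=\min\{[L:K]\}$ and $I(K,X)=\gcd\{[L:K]\}$, where $L$ runs over the finite field extensions of $K$ with $X(L)\ne\emptyset$. Let $m=\min(d,n)$. 1. The degree of every irreducible multi-section of $\pi$ is divisible by $\binom di$ for some $i\in\{1,\dots,m\}$. 2. The degree of every multi-section of $\pi$ lies in the additive semigroup generated by $\binom d1,\dots,\binom dm$. 3. If $d>n$, then $M(K,\mathcal X_{h,K})=d$, and $I(K,\mathcal X_{h,K})$ is divisible by $\gcd\left(\binom d1,\binom d2,\dots,\binom dn\right)$. -/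

import Mathlib

universe u

open CategoryTheory CategoryTheory.Limits AlgebraicGeometry
open scoped Polynomial IntermediateField

noncomputable section

namespace NormPencil

/-! ### Projective space, and hypersurfaces in `ℙ¹ × ℙⁿ` -/

/-- The polynomial ring `k[x₀, …, x_r]` with its grading by degree. -/
abbrev grading (k : Type u) [Field k] (r : ℕ) :
    ℕ → Submodule k (MvPolynomial (Fin (r + 1)) k) :=
  MvPolynomial.homogeneousSubmodule (Fin (r + 1)) k

instance grading.gradedAlgebra (k : Type u) [Field k] (r : ℕ) : GradedAlgebra (grading k r) :=
  MvPolynomial.gradedAlgebra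

/-- Projective space `ℙ^r` over `k`, as a scheme. -/
abbrev PP (k : Type u) [Field k] (r : ℕ) : Scheme.{u} := Proj (grading k r)

/-- The structure morphism `ℙ^r ⟶ Spec k`. -/
abbrev PP.toSpec (k : Type u) [Field k] (r : ℕ) : PP k r ⟶ Spec (CommRingCat.of k) :=
  Proj.toSpecZero (grading k r) ≫
    Spec.map (CommRingCat.ofHom (algebraMap k (grading k r 0)))

/-- The standard affine chart `x_j ≠ 0` of `ℙ^r`. -/
abbrev PP.chart (k : Type u) [Field k] {r : ℕ} (j : Fin (r + 1)) : (PP k r).Opens :=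
  Proj.basicOpen (grading k r) (MvPolynomial.X j)

/-- The regular function `x_b / x_j` on the chart `x_j ≠ 0` of `ℙ^r`. -/
def PP.coord (k : Type u) [Field k] {r : ℕ} (j b : Fin (r + 1)) :
    Γ(PP k r, PP.chart k j) :=
  (Proj.awayToSection (grading k r) (MvPolynomial.X j)).hom
    (HomogeneousLocalization.Away.mk (grading k r) (d := 1)
      (MvPolynomial.isHomogeneous_X k j) 1 (MvPolynomial.X b)
      (MvPolynomial.isHomogeneous_X k b))

/-- `ℙ^r` is irreducible: the zero ideal is a generic point. -/
instance PP.irreducibleSpace (k : Type u) [Field k] (r : ℕ) : IrreducibleSpace (PP k r) := by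
  let η : ProjectiveSpectrum (grading k r) :=
    { asHomogeneousIdeal := ⊥
      isPrime := by
        rw [HomogeneousIdeal.toIdeal_bot]; exact Ideal.isPrime_bot
      not_irrelevant_le := by
        intro h
        have h0 : (MvPolynomial.X 0 : MvPolynomial (Fin (r + 1)) k) ∈
            (⊥ : HomogeneousIdeal (grading k r)) := by
          apply h
          rw [HomogeneousIdeal.mem_irrelevant_iff]
          exact DirectSum.decompose_of_mem_ne (grading k r)
            (MvPolynomial.isHomogeneous_X k 0) one_ne_zero
        rw [← HomogeneousIdeal.mem_iff, HomogeneousIdeal.toIdeal_bot, Ideal.mem_bot] at h0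
        exact MvPolynomial.X_ne_zero 0 h0 }
  have hη : closure ({η} : Set (ProjectiveSpectrum (grading k r))) = Set.univ := by
    rw [Set.eq_univ_iff_forall]
    intro y
    rw [← ProjectiveSpectrum.le_iff_mem_closure]
    exact bot_le (α := HomogeneousIdeal (grading k r))
  have : IsIrreducible (Set.univ : Set (ProjectiveSpectrum (grading k r))) :=
    hη ▸ isIrreducible_singleton.closure
  exact irreducibleSpace_def _ |>.mpr this

/-- The product `ℙ¹ ×_k ℙⁿ`. -/
abbrev P1xPn (k : Type u) [Field k] (n : ℕ) : Scheme.{u} :=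
  pullback (PP.toSpec k 1) (PP.toSpec k n)

/-- The projection `ℙ¹ × ℙⁿ ⟶ ℙ¹`. -/
abbrev P1xPn.fst (k : Type u) [Field k] (n : ℕ) : P1xPn k n ⟶ PP k 1 :=
  pullback.fst (PP.toSpec k 1) (PP.toSpec k n)

/-- The projection `ℙ¹ × ℙⁿ ⟶ ℙⁿ`. -/
abbrev P1xPn.snd (k : Type u) [Field k] (n : ℕ) : P1xPn k n ⟶ PP k n :=
  pullback.snd (PP.toSpec k 1) (PP.toSpec k n)

/-- The chart `u_i ≠ 0`, `x_j ≠ 0` of `ℙ¹ × ℙⁿ`. -/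
abbrev P1xPn.chart (k : Type u) [Field k] {n : ℕ} (c : Fin 2 × Fin (n + 1)) :
    (P1xPn k n).Opens :=
  P1xPn.fst k n ⁻¹ᵁ PP.chart k c.1 ⊓ P1xPn.snd k n ⁻¹ᵁ PP.chart k c.2

/-- Dehomogenisation on the chart `u_i ≠ 0`, `x_j ≠ 0`: a polynomial
`F(u₀, u₁; x₀, …, x_n)` is sent to the function `F(u₀/u_i, u₁/u_i; x₀/x_j, …, x_n/x_j)`. -/
def P1xPn.dehomogenize (k : Type u) [Field k] {n : ℕ} (c : Fin 2 × Fin (n + 1)) :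
    MvPolynomial (Fin 2 ⊕ Fin (n + 1)) k →+* Γ(P1xPn k n, P1xPn.chart k c) :=
  MvPolynomial.eval₂Hom
    ((Scheme.ΓSpecIso (CommRingCat.of k)).inv ≫
      (P1xPn.fst k n ≫ PP.toSpec k 1).appLE ⊤ (P1xPn.chart k c) le_top).hom
    (Sum.elim
      (fun a => ((P1xPn.fst k n).appLE (PP.chart k c.1) (P1xPn.chart k c) inf_le_left).hom
        (PP.coord k c.1 a))
      (fun b => ((P1xPn.snd k n).appLE (PP.chart k c.2) (P1xPn.chart k c) inf_le_right).hom
        (PP.coord k c.2 b)))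

/-- The ideal sheaf on `ℙ¹ × ℙⁿ` of the hypersurface `F = 0`, for `F` bihomogeneous: a function
belongs to it if on each chart it is a multiple of the dehomogenisation of `F`. -/
def hypersurfaceIdeal (k : Type u) [Field k] {n : ℕ}
    (F : MvPolynomial (Fin 2 ⊕ Fin (n + 1)) k) : (P1xPn k n).IdealSheafData :=
  ⨅ c : Fin 2 × Fin (n + 1),
    (Scheme.IdealSheafData.ofIdealTop (X := (P1xPn.chart k c).toScheme)
      (Ideal.span {(P1xPn.chart k c).topIso.inv.hom (P1xPn.dehomogenize k c F)})).map
      (P1xPn.chart k c).ι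

/-! ### The norm of a rational normal curve under a cover `ℙ¹ ⟶ ℙ¹` -/

variable {k : Type u} [Field k]

/-- Let `φ = p / q` be a rational function of degree `d` in lowest terms, that is, the degree `d`
morphism `f : C = ℙ¹ ⟶ B = ℙ¹`, `s ↦ [u₀ : u₁] = [p(s) : q(s)]`.  This is the equation
`u₁ p - u₀ q` of the fibre of `f` over `[u₀ : u₁]`, a binary form of degree `d` in the coordinates
of `C` (written as a polynomial of degree at most `d` in the affine coordinate `s`), with
coefficients in `k[u₀, u₁; x₀, …, x_n]`. -/
def fibreForm (φ : RatFunc k) (n : ℕ) : (MvPolynomial (Fin 2 ⊕ Fin (n + 1)) k)[X] :=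
  Polynomial.C (MvPolynomial.X (Sum.inl 1)) * φ.num.map MvPolynomial.C -
    Polynomial.C (MvPolynomial.X (Sum.inl 0)) * φ.denom.map MvPolynomial.C

/-- Let `G` be a basis of the polynomials of degree at most `n`, that is, of the binary forms of
degree `n`; it gives the rational normal curve `g = [G₀ : … : G_n]` of degree `n` in the dual
projective space, where `g(s)` is regarded as the hyperplane `∑ᵢ Gᵢ(s) xᵢ = 0` of `ℙⁿ`.  This is
the equation `∑ᵢ Gᵢ xᵢ` of that hyperplane, a binary form of degree `n` on `C` with coefficients
in `k[u₀, u₁; x₀, …, x_n]`. -/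
def hyperplaneForm {n : ℕ}
    (G : Module.Basis (Fin (n + 1)) k (Polynomial.degreeLT k (n + 1))) :
    (MvPolynomial (Fin 2 ⊕ Fin (n + 1)) k)[X] :=
  ∑ i, Polynomial.C (MvPolynomial.X (Sum.inr i)) * (G i : k[X]).map MvPolynomial.C

/-- The norm along `f` of the linear form `ℓ = ∑ᵢ Gᵢ xᵢ`, where `d` is the degree of `f`.
The norm is the determinant of multiplication by `ℓ` on the (`d`-dimensional) fibres of `f`; for
binary forms modulo `u₁ p - u₀ q` it is the resultant, that is, the determinant of
`(a, b) ↦ a (u₁ p - u₀ q) + b ℓ`; see `aeval_normForm`.  It is bihomogeneous of degree `n` in `u`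
and `d` in `x`: its coefficients as a form in `x` are the coordinates of the morphism `h` from `B`
to the space of hypersurfaces of degree `d`. -/
def normForm (φ : RatFunc k) {n : ℕ}
    (G : Module.Basis (Fin (n + 1)) k (Polynomial.degreeLT k (n + 1))) (d : ℕ) :
    MvPolynomial (Fin 2 ⊕ Fin (n + 1)) k :=
  Polynomial.resultant (fibreForm φ n) (hyperplaneForm G) d n

/-- If the fibre of `f` over a geometric point `b = [u₀ : u₁]` consists of the points
`c₁, …, c_d` (in the affine chart, with multiplicity), then the fibre of `normForm` over `b` is,
up to a nonzero constant, the product of the linear forms `g(c₁), …, g(c_d)`. -/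
theorem aeval_normForm (φ : RatFunc k) {n : ℕ}
    (G : Module.Basis (Fin (n + 1)) k (Polynomial.degreeLT k (n + 1))) (d : ℕ)
    {E : Type*} [Field E] [Algebra k E] (u : Fin 2 → E) (x : Fin (n + 1) → E) (P : E[X])
    (hP : P = Polynomial.C (u 1) * φ.num.map (algebraMap k E) -
      Polynomial.C (u 0) * φ.denom.map (algebraMap k E))
    (hs : P.Splits) (hd : P.natDegree = d) :
    MvPolynomial.aeval (Sum.elim u x) (normForm φ G d) =
      P.leadingCoeff ^ n *
        (P.roots.map fun c => ∑ i, x i * Polynomial.aeval c (G i : k[X])).prod := by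
  have hG : ∀ i, (G i : k[X]).natDegree ≤ n := fun i =>
    Polynomial.natDegree_le_iff_degree_le.2 (Polynomial.mem_degreeLE.1
      (by simpa [Polynomial.degreeLT_succ_eq_degreeLE] using (G i).2))
  set ev : MvPolynomial (Fin 2 ⊕ Fin (n + 1)) k →+* E :=
    (MvPolynomial.aeval (Sum.elim u x) : _ →ₐ[k] E).toRingHom with hev
  have hC : ev.comp MvPolynomial.C = algebraMap k E := by
    ext a; simp [hev]
  have hl : ∀ v, ev (MvPolynomial.X v) = Sum.elim u x v := fun v => by simp [hev]
  change ev (normForm φ G d) = _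
  have h₁ : (fibreForm φ n).map ev = P := by
    simp [fibreForm, Polynomial.map_map, hC, hl, hP]
  have h₂ : (hyperplaneForm G).map ev =
      ∑ i, Polynomial.C (x i) * (G i : k[X]).map (algebraMap k E) := by
    simp [hyperplaneForm, Polynomial.map_sum, Polynomial.map_map, hC, hl]
  rw [normForm, ← Polynomial.resultant_map_map, h₁, h₂, ← hd,
    Polynomial.resultant_eq_prod_eval _ _ _ _ hs]
  · simp [Polynomial.eval_finsetSum, Polynomial.aeval_def, Polynomial.eval_map]
  · refine Polynomial.natDegree_sum_le_of_forall_le _ _ fun i _ => ?_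
    exact (Polynomial.natDegree_C_mul_le _ _).trans (Polynomial.natDegree_map_le.trans (hG i))

/-- The total space `𝒳_h ⊂ B × ℙⁿ` of the pencil of hypersurfaces of degree `d`. -/
abbrev pencil (φ : RatFunc k) {n : ℕ}
    (G : Module.Basis (Fin (n + 1)) k (Polynomial.degreeLT k (n + 1))) (d : ℕ) : Scheme.{u} :=
  (hypersurfaceIdeal k (normForm φ G d)).subscheme

/-- The projection `π : 𝒳_h ⟶ B`. -/
abbrev pencil.π (φ : RatFunc k) {n : ℕ}
    (G : Module.Basis (Fin (n + 1)) k (Polynomial.degreeLT k (n + 1))) (d : ℕ) :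
    pencil φ G d ⟶ PP k 1 :=
  (hypersurfaceIdeal k (normForm φ G d)).subschemeι ≫ P1xPn.fst k n

/-- The cover `f` given by the rational function `φ` is separable, and the Galois group of (the
Galois closure of) `k(C) / k(B)` is the symmetric group on `d` letters.  Here `k(C)` is the field
of rational functions in one variable and `k(B)` is its subfield generated by `φ`. -/
def HasSymmetricGaloisGroup (φ : RatFunc k) (d : ℕ) : Prop :=
  Algebra.IsSeparable k⟮φ⟯ (RatFunc k) ∧
    Nonempty (Gal(IntermediateField.normalClosure k⟮φ⟯ (RatFunc k)
      (AlgebraicClosure (RatFunc k)) / k⟮φ⟯) ≃* Equiv.Perm (Fin d))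

/-! ### Multi-sections, minimal degree and index -/

/-- A multi-section of `π : X ⟶ B`: a closed subscheme of `X` that is finite and surjective
over `B`. -/
structure IsMultisection {Z X B : Scheme.{u}} (i : Z ⟶ X) (π : X ⟶ B) : Prop where
  isClosedImmersion : IsClosedImmersion i
  isFinite : IsFinite (i ≫ π)
  surjective : Surjective (i ≫ π)

/-- The degree of `ψ : Z ⟶ B` over an irreducible `B`: the dimension, over the residue field of
the generic point of `B`, of the ring of functions of the generic fibre. -/
def genericDegree {Z B : Scheme.{u}} [IrreducibleSpace B] (ψ : Z ⟶ B) : ℕ :=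
  letI : Algebra (B.residueField (genericPoint B)) Γ(ψ.fiber (genericPoint B), ⊤) :=
    ((Scheme.ΓSpecIso _).inv ≫
      (ψ.fiberToSpecResidueField (genericPoint B)).appTop).hom.toAlgebra
  Module.finrank (B.residueField (genericPoint B)) Γ(ψ.fiber (genericPoint B), ⊤)

/-- The degrees `[L : K]` of the finite extensions `L / K` such that the `K`-scheme `X` has an
`L`-point. -/
def pointDegrees (K : Type u) [Field K] {X : Scheme.{u}} (s : X ⟶ Spec (CommRingCat.of K)) :
    Set ℕ :=
  {e | ∃ (L : Type u) (_ : Field L) (_ : Algebra K L), FiniteDimensional K L ∧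
    Module.finrank K L = e ∧
    ∃ x : Spec (CommRingCat.of L) ⟶ X,
      x ≫ s = Spec.map (CommRingCat.ofHom (algebraMap K L))}

/-- The minimal degree `M(K, X)`. -/
def minimalDegree (K : Type u) [Field K] {X : Scheme.{u}} (s : X ⟶ Spec (CommRingCat.of K)) : ℕ :=
  sInf (pointDegrees K s)

/-- The index `I(K, X)`. -/
def index (K : Type u) [Field K] {X : Scheme.{u}} (s : X ⟶ Spec (CommRingCat.of K)) : ℕ :=
  Nat.setGcd (pointDegrees K s)

end NormPencil

end

open NormPencil

/-! ### Factors of a polynomial with symmetric Galois group -/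

namespace NormPencil
open scoped Pointwise

/-! Put `K = k(φ)`, the function field of `B`, and let `P = p - φ q` over `K`, whose roots are the
points of the generic fibre of `f`. A point of the generic fibre of `π` over `L / K` has coordinates
`x`, not all zero, such that `Q = ∑ Gᵢ xᵢ` has zero resultant with `P`. The polynomial `Q` is
nonzero because `G` is a basis, so `D = gcd(P, Q)` has degree `j` with `1 ≤ j ≤ min d n`.

Everything rests on the divisibility of `[L : K]` by `d.choose j`. The polynomial `P` is separable,
so `D` amounts to a set of `j` of its `d` roots. The coefficients of `D` lie both in `L` and in the
splitting field. An automorphism fixing them preserves that set, and the Galois group, being `𝔖_d`,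
moves a `j`-element set through an orbit of size `d.choose j`. This is
`choose_natDegree_dvd_finrank_of_dvd`, applied to the gcd in
`exists_choose_dvd_finrank_of_not_isCoprime`.

The generic fibre of a multi-section is finite over `K`. Its algebra of functions is filtered by
residue fields, each giving a point of the generic fibre of `π`, so its degree is a sum of degrees
of points (`finrank_mem_of_forall_quotient_mem`). If the multi-section is irreducible there is only
one residue field, whose degree divides the total. For `n < d` the lower bound in the third claim is
`d ≤ d.choose j` for `1 ≤ j < d`. It is attained over `k(C)`, by a point of `ℙⁿ` on the hyperplane
`g(c)`, with `c` the generic point of `C`.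

The remaining work identifies the residue field of the generic point of `ℙ¹` with `k(φ)` and
expresses field-valued points of the scheme `𝒳_h` as zeros of the norm form
(`exists_choose_dvd_finrank_of_point`, `exists_ratFunc_point`). -/

theorem choose_dvd_index_of_forall_smul_eq {G α : Type*} [Group G] [MulAction G α] [Finite α]
    [DecidableEq α] (hG : Function.Surjective (MulAction.toPermHom G α)) (s : Finset α)
    (H : Subgroup G) (hH : ∀ g ∈ H, g • s = s) : (Nat.card α).choose s.card ∣ H.index := by
  let t : Set.powersetCard α s.card := Set.powersetCard.ofCard rfl
  -- `H` lies in the stabilizer of `s`, whose index is the size of the orbit, here the set of all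
  -- subsets of the cardinality of `s`.
  have hle : H ≤ MulAction.stabilizer G t := fun g hg => by
    rw [MulAction.mem_stabilizer_iff, Subtype.ext_iff, Set.powersetCard.coe_smul]
    exact hH g hg
  have htr : MulAction.IsPretransitive G (Set.powersetCard α s.card) := by
    have := Set.powersetCard.isPretransitive (α := α) (n := s.card)
    refine ⟨fun x y => ?_⟩
    obtain ⟨σ, hσ⟩ := MulAction.exists_smul_eq (Equiv.Perm α) x y
    obtain ⟨g, rfl⟩ := hG σ
    refine ⟨g, ?_⟩
    rw [← hσ, Subtype.ext_iff, Set.powersetCard.coe_smul, Set.powersetCard.coe_smul]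
    rfl
  have h := Subgroup.index_dvd_of_le hle
  rwa [MulAction.index_stabilizer_of_transitive, Set.powersetCard.card] at h

/-- Inside an algebraic closure `Ω` of `L`, the factor `D` is the product over a set `S` of roots of
`P`, all lying in the image of `N`. Its coefficients therefore lie in `M = N ∩ L`, whose fixing
group preserves `S`. The index of that group is `[M : F]`, which divides `[L : F]`. If `L` is
infinite over `F` the assertion is divisibility of `0`. -/
theorem choose_natDegree_dvd_finrank_of_dvd {F N L : Type*} [Field F] [Field N] [Field L]
    [Algebra F N] [Algebra F L] [IsGalois F N] [FiniteDimensional F N]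
    {P : F[X]} (hsep : P.Separable) (hsplit : (P.map (algebraMap F N)).Splits)
    (hG : Function.Surjective (MulAction.toPermHom Gal(N/F) (P.rootSet N)))
    {D : L[X]} (hD : D.Monic) (hDP : D ∣ P.map (algebraMap F L)) :
    P.natDegree.choose D.natDegree ∣ Module.finrank F L := by
  classical
  let Ω := AlgebraicClosure L
  let j : L →ₐ[F] Ω := IsScalarTower.toAlgHom F L Ω
  let ι : N →ₐ[F] Ω := IsAlgClosed.lift
  have hP0 : P ≠ 0 := hsep.ne_zero
  set DΩ : Polynomial Ω := D.map (j : L →+* Ω) with hDΩ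
  have hPΩ : (P.map (algebraMap F N)).map (ι : N →+* Ω) = P.map (algebraMap F Ω) := by
    rw [Polynomial.map_map, AlgHom.comp_algebraMap]
  have hDPΩ : DΩ ∣ P.map (algebraMap F Ω) := by
    have := Polynomial.map_dvd (j : L →+* Ω) hDP
    rwa [Polynomial.map_map, AlgHom.comp_algebraMap] at this
  have hDΩm : DΩ.Monic := hD.map _
  let S : Finset (P.rootSet N) := Finset.univ.filter fun r => DΩ.eval (ι r) = 0
  let DN : N[X] := ∏ r ∈ S, (Polynomial.X - Polynomial.C (r : N))
  have hroots : S.val.map (fun r : P.rootSet N => ι (r : N)) = DΩ.roots := by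
    refine (Multiset.Nodup.ext ?_ ?_).2 fun a => ?_
    · exact S.nodup.map fun x y h => Subtype.ext (ι.toRingHom.injective h)
    · exact Polynomial.nodup_roots ((hsep.map (f := algebraMap F Ω)).of_dvd hDPΩ)
    · simp only [Multiset.mem_map, Finset.mem_val, S, Finset.mem_filter, Finset.mem_univ, true_and,
        Polynomial.mem_roots hDΩm.ne_zero, Polynomial.IsRoot]
      constructor
      · rintro ⟨r, hr, rfl⟩; exact hr
      · intro ha
        have haP : a ∈ ((P.map (algebraMap F N)).map (ι : N →+* Ω)).roots := by
          rw [hPΩ, Polynomial.mem_roots (Polynomial.map_ne_zero hP0)]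
          exact Polynomial.IsRoot.dvd ha hDPΩ
        rw [hsplit.roots_map, Multiset.mem_map] at haP
        obtain ⟨r, hr, rfl⟩ := haP
        refine ⟨⟨r, ?_⟩, ha, rfl⟩
        simpa [Polynomial.rootSet] using hr
  have hDN : DN.map (ι : N →+* Ω) = DΩ := by
    rw [(IsAlgClosed.splits DΩ).eq_prod_roots_of_monic hDΩm, ← hroots]
    simp [DN, Polynomial.map_prod]
  have hcard : S.card = D.natDegree := by
    rw [← Polynomial.natDegree_map (j : L →+* Ω), ← hDΩ, ← hDN, Polynomial.natDegree_map]
    rw [Polynomial.natDegree_prod_of_monic S (fun r => Polynomial.X - Polynomial.C (r : N))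
      fun r _ => Polynomial.monic_X_sub_C _]
    simp
  have hcardα : Nat.card (P.rootSet N) = P.natDegree := by
    rw [Nat.card_eq_fintype_card, Polynomial.card_rootSet_eq_natDegree hsep hsplit]
  let M : IntermediateField F N := j.fieldRange.comap ι
  have hM : ∀ m, DN.coeff m ∈ M := fun m => by
    change ι (DN.coeff m) ∈ j.fieldRange
    refine ⟨D.coeff m, ?_⟩
    have := congrArg (fun p => p.coeff m) hDN
    simp only [hDΩ, Polynomial.coeff_map] at this
    exact this.symm
  have hevalDN : ∀ r : P.rootSet N, r ∈ S ↔ DN.eval (r : N) = 0 := fun r => by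
    simp only [S, Finset.mem_filter, Finset.mem_univ, true_and]
    rw [← hDN]
    change Polynomial.eval ((ι : N →+* Ω) r) _ = 0 ↔ _
    rw [Polynomial.eval_map_apply, map_eq_zero]
  have hH : ∀ g ∈ M.fixingSubgroup, g • S = S := fun g hg => by
    have hg' : DN.map (g : N →+* N) = DN := by
      ext m
      rw [Polynomial.coeff_map]
      exact (IntermediateField.mem_fixingSubgroup_iff M g).1 hg _ (hM m)
    -- An inclusion suffices, since a translate of `S` has as many elements as `S`.
    refine Finset.eq_of_subset_of_card_le (fun r hr => ?_) (by rw [Finset.card_smul_finset])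
    obtain ⟨s, hs, rfl⟩ := Finset.mem_smul_finset.1 hr
    rw [hevalDN] at hs ⊢
    change DN.eval ((g : N →+* N) s) = 0
    rw [← hg', Polynomial.eval_map_apply, hs, map_zero]
  have h := choose_dvd_index_of_forall_smul_eq hG S M.fixingSubgroup hH
  rw [hcard, hcardα, ← IntermediateField.finrank_eq_fixingSubgroup_index] at h
  refine h.trans ?_
  let e : M →ₐ[F] L := (AlgEquiv.ofInjectiveField j).symm.toAlgHom.comp
    ((ι.comp M.val).codRestrict j.range fun x => x.2)
  let : Algebra M L := e.toRingHom.toAlgebra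
  have : IsScalarTower F M L := IsScalarTower.of_algebraMap_eq fun x => (e.commutes x).symm
  exact ⟨_, (Module.finrank_mul_finrank F M L).symm⟩

end NormPencil

/-! ### The generic fibre of the cover and its Galois group -/

namespace NormPencil

/-- The abstract isomorphism `e` says nothing about the action on the roots and serves only to
count. The action is faithful because the conjugates of `x` generate the normal closure, and an
injection between groups of the same finite order is onto. -/
theorem surjective_toPermHom_rootSet_normalClosure {F R A : Type*} [Field F] [Field R] [Field A]
    [Algebra F R] [Algebra R A] [Algebra F A] [IsScalarTower F R A] [IsAlgClosed A]
    [FiniteDimensional F R] {x : R} (hx : F⟮x⟯ = ⊤) {P : F[X]} (hP : Irreducible P)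
    (hsep : P.Separable) (hPx : Polynomial.aeval x P = 0)
    (e : Gal(IntermediateField.normalClosure F R A / F) ≃* Equiv.Perm (Fin P.natDegree)) :
    (P.map (algebraMap F (IntermediateField.normalClosure F R A))).Splits ∧
      Function.Surjective (MulAction.toPermHom Gal(IntermediateField.normalClosure F R A / F)
        (P.rootSet (IntermediateField.normalClosure F R A))) := by
  set N := IntermediateField.normalClosure F R A with hN
  have hcl : IsNormalClosure F R N :=
    Algebra.IsAlgebraic.isNormalClosure_normalClosure fun y => IsAlgClosed.splits _
  obtain ⟨hsplits, htop⟩ := Algebra.IsAlgebraic.isNormalClosure_iff.1 hcl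
  have hxi : IsIntegral F x := Algebra.IsIntegral.isIntegral x
  have hsplit : (P.map (algebraMap F N)).Splits :=
    (hsplits x).of_dvd (Polynomial.map_ne_zero (minpoly.ne_zero hxi)) (Polynomial.map_dvd _
      ((minpoly.irreducible hxi).dvd_symm hP (minpoly.dvd F x hPx)))
  refine ⟨hsplit, ?_⟩
  have hinj : Function.Injective (MulAction.toPermHom Gal(N/F) (P.rootSet N)) := by
    rw [injective_iff_map_eq_one]
    intro g hg
    -- If `g` fixes all roots, its fixed field contains every `F`-embedded copy of `R = F(x)`, hence
    -- the whole normal closure.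
    set E := IntermediateField.fixedField (Subgroup.zpowers g) with hE
    have hmem : ∀ y : N, y ∈ E ↔ g y = y := fun y => by
      rw [IntermediateField.mem_fixedField_iff]
      refine ⟨fun h => h g (Subgroup.mem_zpowers g), fun h f hf => ?_⟩
      have hle : Subgroup.zpowers g ≤ MulAction.stabilizer Gal(N/F) y := by
        rwa [Subgroup.zpowers_le, MulAction.mem_stabilizer_iff]
      exact hle hf
    have hfix : IntermediateField.normalClosure F R N ≤ E := by
      rw [normalClosure_le_iff]
      rintro f _ ⟨y, rfl⟩
      have hxE : F⟮x⟯ ≤ E.comap f := by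
        rw [IntermediateField.adjoin_simple_le_iff]
        refine (hmem _).2 ?_
        have hfx : f x ∈ P.rootSet N := Polynomial.mem_rootSet.2
          ⟨hP.ne_zero, by rw [Polynomial.aeval_algHom_apply, hPx, map_zero]⟩
        exact congrArg (fun σ => ((σ ⟨f x, hfx⟩ : P.rootSet N) : N)) hg
      exact hxE (hx ▸ IntermediateField.mem_top)
    exact AlgEquiv.ext fun y => (hmem y).1 (hfix (htop ▸ IntermediateField.mem_top))
  have hcard : Nat.card (Equiv.Perm (P.rootSet N)) = Nat.card Gal(N/F) := by
    rw [Nat.card_congr e.toEquiv, Nat.card_perm, Nat.card_perm, Nat.card_fin,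
      Nat.card_eq_fintype_card, Polynomial.card_rootSet_eq_natDegree hsep hsplit]
  exact (hinj.bijective_of_nat_card_le hcard.le).2

theorem isGalois_normalClosure (F R A : Type*) [Field F] [Field R] [Field A] [Algebra F R]
    [Algebra R A] [Algebra F A] [IsScalarTower F R A] [IsAlgClosed A] [Algebra.IsSeparable F R] :
    IsGalois F (IntermediateField.normalClosure F R A) where
  to_isSeparable := by
    have (f : R →ₐ[F] A) : Algebra.IsSeparable F f.fieldRange :=
      AlgEquiv.Algebra.isSeparable (AlgEquiv.ofInjectiveField f)
    exact IntermediateField.isSeparable_iSup F A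
  to_normal := (Algebra.IsAlgebraic.isNormalClosure_normalClosure (K := R)
    fun _ => IsAlgClosed.splits _).normal

variable {k : Type u} [Field k]

/-- The polynomial `p - φ q` over `k(φ)`, where `φ = p / q` in lowest terms; its roots are the
points of the generic fibre of the cover given by `φ`. -/
noncomputable def fibrePolynomial (φ : RatFunc k) : Polynomial k⟮φ⟯ :=
  φ.num.map (algebraMap k k⟮φ⟯) -
    Polynomial.C (IntermediateField.AdjoinSimple.gen k φ) * φ.denom.map (algebraMap k k⟮φ⟯)

open scoped IntermediateField.algebraAdjoinAdjoin in
theorem fibrePolynomial_eq_minpolyX (φ : RatFunc k) : fibrePolynomial φ = φ.minpolyX k⟮φ⟯ := rfl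

theorem natDegree_fibrePolynomial (φ : RatFunc k) :
    (fibrePolynomial φ).natDegree = Module.finrank k⟮φ⟯ (RatFunc k) := by
  rw [fibrePolynomial_eq_minpolyX, RatFunc.natDegree_minpolyX, RatFunc.finrank_eq_max_natDegree]

theorem aeval_X_fibrePolynomial (φ : RatFunc k) :
    Polynomial.aeval (RatFunc.X : RatFunc k) (fibrePolynomial φ) = 0 := by
  rw [fibrePolynomial_eq_minpolyX, RatFunc.minpolyX_aeval_X]

theorem ne_C_of_finrank_pos {φ : RatFunc k} (h : 0 < Module.finrank k⟮φ⟯ (RatFunc k)) :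
    ¬ ∃ c, φ = RatFunc.C c := fun hc => by
  rw [RatFunc.finrank_eq_max_natDegree, ((RatFunc.eq_C_iff φ).1 hc).1,
    ((RatFunc.eq_C_iff φ).1 hc).2] at h
  simp at h

/-- The integer `j` is the degree of the monic gcd. It is positive by non-coprimality and at most
`d` and `n` because the gcd divides both polynomials. -/
theorem exists_choose_dvd_finrank_of_not_isCoprime {d : ℕ} (hd : 0 < d) {φ : RatFunc k}
    (hφ : Module.finrank k⟮φ⟯ (RatFunc k) = d) (hGal : HasSymmetricGaloisGroup φ d)
    {L : Type*} [Field L] [Algebra k⟮φ⟯ L] {n : ℕ} {Q : L[X]} (hQ : Q ≠ 0) (hQn : Q.natDegree ≤ n)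
    (h : ¬ IsCoprime ((fibrePolynomial φ).map (algebraMap k⟮φ⟯ L)) Q) :
    ∃ j ∈ Finset.Icc 1 (min d n), d.choose j ∣ Module.finrank k⟮φ⟯ L := by
  classical
  have hC := ne_C_of_finrank_pos (hφ ▸ hd)
  set P := fibrePolynomial φ with hPdef
  have hdeg : P.natDegree = d := by rw [hPdef, natDegree_fibrePolynomial, hφ]
  have hfin : FiniteDimensional k⟮φ⟯ (RatFunc k) := FiniteDimensional.of_finrank_pos (hφ ▸ hd)
  have hirr : Irreducible P := by
    rw [hPdef, fibrePolynomial_eq_minpolyX]; exact RatFunc.irreducible_minpolyX φ hC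
  have hroot : Polynomial.aeval (RatFunc.X : RatFunc k) P = 0 := aeval_X_fibrePolynomial φ
  obtain ⟨hs, ⟨e⟩⟩ := hGal
  have hXi : IsIntegral k⟮φ⟯ (RatFunc.X : RatFunc k) := Algebra.IsIntegral.isIntegral _
  have hsep : P.Separable := Polynomial.Separable.of_dvd
    (Algebra.IsSeparable.isSeparable k⟮φ⟯ (RatFunc.X : RatFunc k))
    ((minpoly.irreducible hXi).dvd_symm hirr (minpoly.dvd _ _ hroot))
  obtain ⟨hsplit, hsurj⟩ := surjective_toPermHom_rootSet_normalClosure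
    (A := AlgebraicClosure (RatFunc k)) (RatFunc.IntermediateField.adjoin_X k⟮φ⟯) hirr hsep hroot
    (hdeg ▸ e)
  have := isGalois_normalClosure k⟮φ⟯ (RatFunc k) (AlgebraicClosure (RatFunc k))
  set PL := P.map (algebraMap k⟮φ⟯ L) with hPL
  have hPL0 : PL ≠ 0 := Polynomial.map_ne_zero hirr.ne_zero
  have hD0 : gcd PL Q ≠ 0 := fun h => hQ ((gcd_eq_zero_iff _ _).1 h).2
  have hDm : (gcd PL Q).Monic := by
    rw [← normalize_gcd]; exact Polynomial.monic_normalize hD0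
  refine ⟨(gcd PL Q).natDegree, ?_, hdeg ▸
    choose_natDegree_dvd_finrank_of_dvd hsep hsplit hsurj hDm (gcd_dvd_left _ _)⟩
  rw [Finset.mem_Icc, le_min_iff]
  refine ⟨?_, ?_, ?_⟩
  · rw [Nat.one_le_iff_ne_zero]
    intro h0
    exact h ((gcd_isUnit_iff _ _).1 ((hDm.natDegree_eq_zero).1 h0 ▸ isUnit_one))
  · rw [← hdeg, ← Polynomial.natDegree_map (algebraMap k⟮φ⟯ L)]
    exact Polynomial.natDegree_le_of_dvd (gcd_dvd_left _ _) hPL0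
  · exact (Polynomial.natDegree_le_of_dvd (gcd_dvd_right _ _) hQ).trans hQn

end NormPencil

/-! ### The norm form as a resultant -/

namespace NormPencil
variable {k : Type u} [Field k]

section eval

variable {n : ℕ} {E : Type*} [CommRing E]
  (G : Module.Basis (Fin (n + 1)) k (Polynomial.degreeLT k (n + 1)))
  (ev : MvPolynomial (Fin 2 ⊕ Fin (n + 1)) k →+* E)

theorem map_fibreForm (φ : RatFunc k) : (fibreForm φ n).map ev =
    Polynomial.C (ev (MvPolynomial.X (Sum.inl 1))) * φ.num.map (ev.comp MvPolynomial.C) -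
      Polynomial.C (ev (MvPolynomial.X (Sum.inl 0))) * φ.denom.map (ev.comp MvPolynomial.C) := by
  simp [fibreForm, Polynomial.map_map]

theorem map_hyperplaneForm : (hyperplaneForm G).map ev =
    ∑ i, Polynomial.C (ev (MvPolynomial.X (Sum.inr i))) *
      (G i : k[X]).map (ev.comp MvPolynomial.C) := by
  simp [hyperplaneForm, Polynomial.map_sum, Polynomial.map_map]

theorem map_normForm (φ : RatFunc k) (d : ℕ) : ev (normForm φ G d) =
    Polynomial.resultant ((fibreForm φ n).map ev) ((hyperplaneForm G).map ev) d n := by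
  rw [normForm, Polynomial.resultant_map_map]

/-- Bihomogeneity of the norm form, in the shape needed for changing charts and for rescaling
coordinates. -/
theorem map_normForm_eq_mul (φ : RatFunc k) (d : ℕ)
    (ev' : MvPolynomial (Fin 2 ⊕ Fin (n + 1)) k →+* E)
    (hC : ev'.comp MvPolynomial.C = ev.comp MvPolynomial.C) (a b : E)
    (hu : ∀ i, ev' (MvPolynomial.X (Sum.inl i)) = a * ev (MvPolynomial.X (Sum.inl i)))
    (hx : ∀ i, ev' (MvPolynomial.X (Sum.inr i)) = b * ev (MvPolynomial.X (Sum.inr i))) :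
    ev' (normForm φ G d) = a ^ n * b ^ d * ev (normForm φ G d) := by
  have h₁ : (fibreForm φ n).map ev' = Polynomial.C a * (fibreForm φ n).map ev := by
    simp only [map_fibreForm, hC, hu, map_mul]; ring
  have h₂ : (hyperplaneForm G).map ev' = Polynomial.C b * (hyperplaneForm G).map ev := by
    simp only [map_hyperplaneForm, hC, hx, map_mul, Finset.mul_sum, mul_assoc]
  rw [map_normForm, map_normForm, h₁, h₂, Polynomial.resultant_C_mul_left,
    Polynomial.resultant_C_mul_right, mul_assoc]

theorem natDegree_map_hyperplaneForm_le : ((hyperplaneForm G).map ev).natDegree ≤ n := by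
  have hG : ∀ i, (G i : k[X]).natDegree ≤ n := fun i =>
    Polynomial.natDegree_le_iff_degree_le.2 (Polynomial.mem_degreeLE.1
      (by simpa [Polynomial.degreeLT_succ_eq_degreeLE] using (G i).2))
  rw [map_hyperplaneForm]
  refine Polynomial.natDegree_sum_le_of_forall_le _ _ fun i _ => ?_
  exact (Polynomial.natDegree_C_mul_le _ _).trans (Polynomial.natDegree_map_le.trans (hG i))

theorem map_hyperplaneForm_ne_zero {i : Fin (n + 1)}
    (hi : ev (MvPolynomial.X (Sum.inr i)) ≠ 0) : (hyperplaneForm G).map ev ≠ 0 := by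
  classical
  -- `A` holds the coefficients of the basis and `B` those of the inverse change of basis. The
  -- relation `A * B = 1` survives in every `E`, so a vanishing combination of the `G i` has zero
  -- coefficients even when `E` is not a field.
  let A : Matrix (Fin (n + 1)) (Fin (n + 1)) k := .of fun i m => (G i : k[X]).coeff m
  let pw (m : Fin (n + 1)) : Polynomial.degreeLT k (n + 1) :=
    ⟨Polynomial.X ^ (m : ℕ), Polynomial.mem_degreeLT.2
      ((Polynomial.degree_X_pow_le _).trans_lt (by exact_mod_cast m.2))⟩
  let B : Matrix (Fin (n + 1)) (Fin (n + 1)) k := .of fun m i => G.repr (pw m) i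
  have hBA : B * A = 1 := by
    ext m m'
    have h : (∑ i, G.repr (pw m) i • (G i : k[X])) = Polynomial.X ^ (m : ℕ) := by
      have := congrArg (Polynomial.degreeLT k (n + 1)).subtype (G.sum_repr (pw m))
      rwa [map_sum] at this
    have h' := congrArg (fun p => p.coeff (m' : ℕ)) h
    simp only [Polynomial.finsetSum_coeff, Polynomial.coeff_smul, smul_eq_mul,
      Polynomial.coeff_X_pow] at h'
    rw [Matrix.mul_apply, Matrix.one_apply]
    simp only [A, B, Matrix.of_apply, h', Fin.ext_iff, eq_comm]
  have hAB : A * B = 1 := mul_eq_one_comm.1 hBA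
  intro h0
  let x : Fin (n + 1) → E := fun i => ev (MvPolynomial.X (Sum.inr i))
  let f := ev.comp (MvPolynomial.C : k →+* _)
  have hx : Matrix.vecMul x (A.map f) = 0 := by
    ext m
    have := congrArg (fun p => p.coeff (m : ℕ)) h0
    simpa [map_hyperplaneForm, Matrix.vecMul, dotProduct, x, A, f, Polynomial.finsetSum_coeff]
      using this
  have : x = 0 := by
    rw [← Matrix.vecMul_one x, ← (Matrix.map_one f (map_zero f) (map_one f)), ← hAB, Matrix.map_mul,
      ← Matrix.vecMul_vecMul, hx, Matrix.zero_vecMul]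
  exact hi (congrFun this i)

end eval

/-- Raising the formal degree of `g` above its true degree only multiplies the resultant, up to
sign, by a power of the leading coefficient of `f`. That `f` has its exact degree is what excludes a
spurious common root at infinity. -/
theorem resultant_natDegree_eq_zero_iff {E : Type*} [Field E] {f g : E[X]} (hf : f ≠ 0) {n : ℕ}
    (hg : g.natDegree ≤ n) : Polynomial.resultant f g f.natDegree n = 0 ↔ ¬ IsCoprime f g := by
  obtain ⟨c, rfl⟩ := Nat.exists_eq_add_of_le hg
  rw [Polynomial.resultant_add_right_deg _ _ _ _ _ le_rfl, mul_eq_zero,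
    Polynomial.resultant_eq_zero_iff]
  simp [hf]

theorem map_normForm_eq_zero_iff {n d : ℕ} {E : Type*} [Field E]
    (G : Module.Basis (Fin (n + 1)) k (Polynomial.degreeLT k (n + 1)))
    (ev : MvPolynomial (Fin 2 ⊕ Fin (n + 1)) k →+* E) (φ : RatFunc k)
    (h0 : (fibreForm φ n).map ev ≠ 0) (hd : ((fibreForm φ n).map ev).natDegree = d) :
    ev (normForm φ G d) = 0 ↔
      ¬ IsCoprime ((fibreForm φ n).map ev) ((hyperplaneForm G).map ev) := by
  rw [map_normForm, ← hd,
    resultant_natDegree_eq_zero_iff h0 (natDegree_map_hyperplaneForm_le G ev)]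

section cover

variable {n : ℕ} {φ : RatFunc k} {L : Type*} [Field L] [Algebra k⟮φ⟯ L]
  (ev : MvPolynomial (Fin 2 ⊕ Fin (n + 1)) k →+* L)

theorem map_fibreForm_eq_map_fibrePolynomial
    (hC : ev.comp MvPolynomial.C = (algebraMap k⟮φ⟯ L).comp (algebraMap k k⟮φ⟯))
    (h₁ : ev (MvPolynomial.X (Sum.inl 1)) = 1)
    (h₀ : ev (MvPolynomial.X (Sum.inl 0)) =
      algebraMap k⟮φ⟯ L (IntermediateField.AdjoinSimple.gen k φ)) :
    (fibreForm φ n).map ev = (fibrePolynomial φ).map (algebraMap k⟮φ⟯ L) := by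
  rw [map_fibreForm, hC, h₁, h₀, fibrePolynomial]
  simp [Polynomial.map_map]

theorem exists_choose_dvd_finrank_of_map_normForm_eq_zero {d : ℕ} (hd : 0 < d)
    (hφ : Module.finrank k⟮φ⟯ (RatFunc k) = d) (hGal : HasSymmetricGaloisGroup φ d)
    (G : Module.Basis (Fin (n + 1)) k (Polynomial.degreeLT k (n + 1)))
    (hC : ev.comp MvPolynomial.C = (algebraMap k⟮φ⟯ L).comp (algebraMap k k⟮φ⟯))
    (h₁ : ev (MvPolynomial.X (Sum.inl 1)) = 1)
    (h₀ : ev (MvPolynomial.X (Sum.inl 0)) =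
      algebraMap k⟮φ⟯ L (IntermediateField.AdjoinSimple.gen k φ))
    {i : Fin (n + 1)} (hi : ev (MvPolynomial.X (Sum.inr i)) ≠ 0)
    (h : ev (normForm φ G d) = 0) :
    ∃ j ∈ Finset.Icc 1 (min d n), d.choose j ∣ Module.finrank k⟮φ⟯ L := by
  have hP := map_fibreForm_eq_map_fibrePolynomial ev hC h₁ h₀
  have hdeg : ((fibreForm φ n).map ev).natDegree = d := by
    rw [hP, Polynomial.natDegree_map, natDegree_fibrePolynomial, hφ]
  have h0 : (fibreForm φ n).map ev ≠ 0 := fun h0 => by simp [h0] at hdeg; omega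
  rw [map_normForm_eq_zero_iff G ev φ h0 hdeg, hP] at h
  exact exists_choose_dvd_finrank_of_not_isCoprime hd hφ hGal
    (map_hyperplaneForm_ne_zero G ev hi) (natDegree_map_hyperplaneForm_le G ev) h

/-- Some hyperplane section of the rational normal curve over `k(C)` passes through the generic point
of `C`. -/
theorem exists_map_normForm_eq_zero {d n : ℕ} (hd : 0 < d) (hn : 0 < n) {φ : RatFunc k}
    (hφ : Module.finrank k⟮φ⟯ (RatFunc k) = d)
    (G : Module.Basis (Fin (n + 1)) k (Polynomial.degreeLT k (n + 1))) :
    ∃ x : Fin (n + 1) → RatFunc k, x ≠ 0 ∧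
      MvPolynomial.eval₂Hom (algebraMap k (RatFunc k)) (Sum.elim ![φ, 1] x)
        (normForm φ G d) = 0 := by
  let v : Fin (n + 1) → RatFunc k := fun i => Polynomial.aeval RatFunc.X (G i : k[X])
  -- One linear equation in `n + 1 ≥ 2` unknowns has a nonzero solution; this is where `0 < n`
  -- enters.
  obtain ⟨x, hxv, hx0⟩ : ∃ x : Fin (n + 1) → RatFunc k, ∑ i, x i * v i = 0 ∧ x ≠ 0 := by
    have h := LinearMap.ker_ne_bot_of_finrank_lt (f := Fintype.linearCombination (RatFunc k) v)
      (by simpa using hn)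
    obtain ⟨x, hx, hx0⟩ := (Submodule.ne_bot_iff _).1 h
    exact ⟨x, by simpa [Fintype.linearCombination_apply] using hx, hx0⟩
  refine ⟨x, hx0, ?_⟩
  set ev : MvPolynomial (Fin 2 ⊕ Fin (n + 1)) k →+* RatFunc k :=
    MvPolynomial.eval₂Hom (algebraMap k (RatFunc k)) (Sum.elim ![φ, 1] x) with hev
  have hC : ev.comp MvPolynomial.C = (algebraMap k⟮φ⟯ (RatFunc k)).comp (algebraMap k k⟮φ⟯) := by
    ext a; simp [hev]
  have hP := map_fibreForm_eq_map_fibrePolynomial ev hC (by simp [hev]) (by simp [hev])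
  have hdeg : ((fibreForm φ n).map ev).natDegree = d := by
    rw [hP, Polynomial.natDegree_map, natDegree_fibrePolynomial, hφ]
  have h0 : (fibreForm φ n).map ev ≠ 0 := fun h0 => by simp [h0] at hdeg; omega
  rw [map_normForm_eq_zero_iff G ev φ h0 hdeg]
  -- Both polynomials vanish at the tautological element `X` of `k(C)`, which contradicts a Bézout
  -- relation.
  rintro ⟨a, b, hab⟩
  have := congrArg (Polynomial.eval (RatFunc.X : RatFunc k)) hab
  have e₁ : ((fibreForm φ n).map ev).eval (RatFunc.X : RatFunc k) = 0 := by
    rw [hP, Polynomial.eval_map_algebraMap, aeval_X_fibrePolynomial]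
  have e₂ : ((hyperplaneForm G).map ev).eval (RatFunc.X : RatFunc k) = 0 := by
    rw [map_hyperplaneForm, Polynomial.eval_finsetSum, ← hxv]
    refine Finset.sum_congr rfl fun i _ => ?_
    rw [Polynomial.eval_mul, Polynomial.eval_C, Polynomial.eval_map]
    simp [hev, v, Polynomial.aeval_def, MvPolynomial.eval₂Hom, RingHom.comp]
  simp [e₁, e₂] at this

end cover

end NormPencil

/-! ### Dimensions of modules over a finite-dimensional algebra -/

namespace NormPencil

/-- A finite module over a Noetherian ring has a filtration with quotients `A ⧸ p`, and dimension is
additive in exact sequences. The `K`-structure is quantified after `M` because the induction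
supplies only `A`-modules. -/
theorem finrank_mem_of_forall_quotient_mem {K A : Type u} [Field K] [CommRing A] [Algebra K A]
    [FiniteDimensional K A] (T : AddSubmonoid ℕ)
    (h : ∀ p : Ideal A, p.IsPrime → Module.finrank K (A ⧸ p) ∈ T) (M : Type u) [AddCommGroup M]
    [Module A M] [hM : Module.Finite A M] :
    ∀ [Module K M] [IsScalarTower K A M], Module.finrank K M ∈ T := by
  have hA : IsNoetherianRing A := IsNoetherianRing.of_finite K A
  induction hM using IsNoetherianRing.induction_on_isQuotientEquivQuotientPrime A with
  | subsingleton N =>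
    intro _ _
    rw [Module.finrank_zero_of_subsingleton]
    exact T.zero_mem
  | quotient N p e =>
    intro _ _
    rw [(e.restrictScalars K).finrank_eq]
    exact h p.1 p.2
  | exact N₁ N₂ N₃ f g hf hg hfg h₁ h₃ =>
    intro _ _
    let : Module K N₁ := Module.compHom N₁ (algebraMap K A)
    let : Module K N₃ := Module.compHom N₃ (algebraMap K A)
    have : IsScalarTower K A N₁ := .of_compHom K A N₁
    have : IsScalarTower K A N₃ := .of_compHom K A N₃
    have : Module.Finite K N₂ := Module.Finite.trans A _
    have hdim := (g.restrictScalars K).finrank_range_add_finrank_ker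
    have hker : (g.restrictScalars K).ker = (f.restrictScalars K).range :=
      LinearMap.exact_iff.1
        (show Function.Exact (f.restrictScalars K) (g.restrictScalars K) from hfg)
    rw [LinearMap.range_eq_top.2 (show Function.Surjective (g.restrictScalars K) from hg),
      finrank_top, hker, LinearMap.finrank_range_of_inj
      (show Function.Injective (f.restrictScalars K) from hf)] at hdim
    exact hdim ▸ add_mem h₃ h₁

/-- The filtration argument yields a possibly empty sum, whereas the theorem speaks of a semigroup;
only the value `0` separates the two. -/
theorem eq_zero_or_mem_addSubsemigroup_closure {M : Type*} [AddMonoid M] {s : Set M} {x : M}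
    (hx : x ∈ AddSubmonoid.closure s) : x = 0 ∨ x ∈ AddSubsemigroup.closure s := by
  induction hx using AddSubmonoid.closure_induction with
  | mem x hx => exact .inr (AddSubsemigroup.subset_closure hx)
  | zero => exact .inl rfl
  | add x y _ _ hx hy =>
    rcases hx with rfl | hx
    · simpa using hy
    · rcases hy with rfl | hy
      · simpa using Or.inr hx
      · exact .inr (add_mem hx hy)

end NormPencil

/-! ### Field-valued points of projective space and their coordinates -/

noncomputable section
namespace NormPencil

section evalAt

variable {L : Type u} [CommRing L] {X Y : Scheme.{u}}

/-- The value at an `L`-valued point `f` of `X` of a function on a neighbourhood `U`. -/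
def evalAt (f : Spec (CommRingCat.of L) ⟶ X) (U : X.Opens) (h : ⊤ ≤ f ⁻¹ᵁ U) : Γ(X, U) →+* L :=
  ((f.appLE U ⊤ h) ≫ (Scheme.ΓSpecIso (CommRingCat.of L)).hom).hom

theorem top_le_preimage_of_mem {L : Type u} [Field L] {f : Spec (CommRingCat.of L) ⟶ X}
    {U : X.Opens} {z : Spec (CommRingCat.of L)} (h : f z ∈ U) : ⊤ ≤ f ⁻¹ᵁ U := fun w _ => by
  rw [Subsingleton.elim w z]; exact h

theorem evalAt_comp (f : Spec (CommRingCat.of L) ⟶ X) (g : X ⟶ Y) (U : Y.Opens) (V : X.Opens)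
    (hU : V ≤ g ⁻¹ᵁ U) (hV : ⊤ ≤ f ⁻¹ᵁ V) (s : Γ(Y, U)) :
    evalAt f V hV ((g.appLE U V hU).hom s) =
      evalAt (f ≫ g) U (hV.trans (f.preimage_mono hU)) s := by
  simp only [evalAt]
  rw [← Scheme.Hom.appLE_comp_appLE f g U V ⊤ hU hV]
  simp

theorem evalAt_map (f : Spec (CommRingCat.of L) ⟶ X) {U V : X.Opens} (hVU : V ≤ U)
    (hV : ⊤ ≤ f ⁻¹ᵁ V) (s : Γ(X, U)) :
    evalAt f V hV ((X.presheaf.map (homOfLE hVU).op).hom s) =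
      evalAt f U (hV.trans (f.preimage_mono hVU)) s := by
  simp only [evalAt]
  rw [← Scheme.Hom.map_appLE f hV (homOfLE hVU).op]
  rfl

theorem evalAt_specMap_comp {L' : Type u} [CommRing L'] (a : L →+* L')
    (f : Spec (CommRingCat.of L) ⟶ X) (U : X.Opens) (h : ⊤ ≤ f ⁻¹ᵁ U)
    (h' : ⊤ ≤ (Spec.map (CommRingCat.ofHom a) ≫ f) ⁻¹ᵁ U) (s : Γ(X, U)) :
    evalAt (Spec.map (CommRingCat.ofHom a) ≫ f) U h' s = a (evalAt f U h s) := by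
  simp only [evalAt]
  rw [← Scheme.Hom.appLE_comp_appLE (Spec.map (CommRingCat.ofHom a)) f U ⊤ ⊤ h le_top]
  have h₁ : (Spec.map (CommRingCat.ofHom a)).appLE ⊤ ⊤ le_top =
      (Spec.map (CommRingCat.ofHom a)).appTop := by
    simp [Scheme.Hom.appTop, Scheme.Hom.app_eq_appLE]
  rw [h₁, Category.assoc, Scheme.ΓSpecIso_naturality]
  rfl

theorem evalAt_eq_zero_iff {L : Type u} [Field L] (f : Spec (CommRingCat.of L) ⟶ X)
    (U : X.Opens) (h : ⊤ ≤ f ⁻¹ᵁ U) (s : Γ(X, U)) (z : Spec (CommRingCat.of L)) :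
    evalAt f U h s = 0 ↔ f z ∉ X.basicOpen s := by
  have h₁ : f z ∈ X.basicOpen s ↔ z ∈ (Spec (CommRingCat.of L)).basicOpen (f.appLE U ⊤ h s) := by
    rw [Scheme.basicOpen_appLE, top_inf_eq]
    rfl
  have h₂ : z.asIdeal = ⊥ := (Ideal.eq_bot_or_top z.asIdeal).resolve_right z.2.ne_top
  rw [h₁, basicOpen_eq_of_affine']
  change _ ↔ ¬ (evalAt f U h s ∉ z.asIdeal)
  rw [h₂, not_not, Ideal.mem_bot]

end evalAt

variable {k : Type u} [Field k] {r : ℕ}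

theorem X_mem_grading (j : Fin (r + 1)) : MvPolynomial.X j ∈ grading k r 1 :=
  MvPolynomial.isHomogeneous_X k j

/-- The function `x_b / x_j`, as an element of the degree zero part of `k[x]_{x_j}`. -/
def awayCoord (k : Type u) [Field k] {r : ℕ} (j b : Fin (r + 1)) :
    HomogeneousLocalization.Away (grading k r) (MvPolynomial.X j) :=
  HomogeneousLocalization.Away.mk (grading k r) (d := 1) (X_mem_grading j) 1 (MvPolynomial.X b)
    (X_mem_grading b)

theorem coord_eq (j b : Fin (r + 1)) : PP.coord k j b =
    (Proj.awayToSection (grading k r) (MvPolynomial.X j)).hom (awayCoord k j b) := rfl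

theorem val_awayCoord (j b : Fin (r + 1)) : (awayCoord k j b).val =
    Localization.mk (S := Submonoid.powers (MvPolynomial.X j : MvPolynomial (Fin (r + 1)) k))
      (MvPolynomial.X b) ⟨MvPolynomial.X j ^ 1, 1, rfl⟩ :=
  HomogeneousLocalization.Away.val_mk ..

theorem coord_self (j : Fin (r + 1)) : PP.coord k j j = 1 := by
  have : awayCoord k j j = 1 := by
    rw [HomogeneousLocalization.ext_iff_val, val_awayCoord, HomogeneousLocalization.val_one]
    simp only [pow_one]
    exact Localization.mk_self ⟨MvPolynomial.X j, _⟩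
  rw [coord_eq, this, map_one]

theorem isScalarTower_grading_zero :
    IsScalarTower k (grading k r 0) (MvPolynomial (Fin (r + 1)) k) :=
  ⟨fun a x y => by
    change (((a • x : grading k r 0) : MvPolynomial (Fin (r + 1)) k)) * y = a • (x.1 * y)
    exact smul_mul_assoc a x.1 y⟩

theorem iSup_chart : ⨆ j : Fin (r + 1), PP.chart k j = ⊤ := by
  refine Proj.iSup_basicOpen_eq_top' _ _ (fun i => ⟨1, MvPolynomial.isHomogeneous_X k i⟩) ?_
  have := isScalarTower_grading_zero (k := k) (r := r)
  rw [eq_top_iff]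
  intro p _
  have hp : p ∈ Algebra.adjoin k (Set.range (MvPolynomial.X : Fin (r + 1) → _)) := by
    rw [MvPolynomial.adjoin_range_X]; trivial
  have h : Algebra.adjoin k
      (Set.range (MvPolynomial.X : Fin (r + 1) → MvPolynomial (Fin (r + 1)) k)) ≤
      (Algebra.adjoin (grading k r 0) (Set.range MvPolynomial.X)).restrictScalars k :=
    Algebra.adjoin_le Algebra.subset_adjoin
  exact h hp

/-- This is `x_b / x_j = (x_i / x_j) (x_b / x_i)`, checked in the localization at `x_j x_i`. It
gives the scaling factor between the coordinates of a point in two charts. -/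
theorem evalAt_coord {L : Type u} [Field L] (g : Spec (CommRingCat.of L) ⟶ PP k r)
    (i j b : Fin (r + 1)) (hi : ⊤ ≤ g ⁻¹ᵁ PP.chart k i) (hj : ⊤ ≤ g ⁻¹ᵁ PP.chart k j) :
    evalAt g _ hj (PP.coord k j b) =
      evalAt g _ hj (PP.coord k j i) * evalAt g _ hi (PP.coord k i b) := by
  set V := Proj.basicOpen (grading k r) (MvPolynomial.X j * MvPolynomial.X i) with hV
  have hVj : V ≤ PP.chart k j := Proj.basicOpen_mono _ _ _ ⟨_, rfl⟩
  have hVi : V ≤ PP.chart k i := Proj.basicOpen_mono _ _ _ ⟨_, mul_comm _ _⟩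
  have hgV : ⊤ ≤ g ⁻¹ᵁ V := by
    rw [hV, Proj.basicOpen_mul]
    exact le_inf hj hi
  have hres (f c : Fin (r + 1)) (i' : Fin (r + 1))
      (hx : (MvPolynomial.X j * MvPolynomial.X i : MvPolynomial (Fin (r + 1)) k) =
        MvPolynomial.X f * MvPolynomial.X i') (h : V ≤ PP.chart k f) (hg) :
      evalAt g (PP.chart k f) hg (PP.coord k f c) = evalAt g V hgV
        ((Proj.awayToSection (grading k r) (MvPolynomial.X j * MvPolynomial.X i)).hom
          (HomogeneousLocalization.awayMap (grading k r) (X_mem_grading i') hx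
            (awayCoord k f c))) := by
    rw [← evalAt_map g h hgV, coord_eq]
    congr 1
    exact (ConcreteCategory.congr_hom
      (Proj.awayMap_awayToSection (grading k r) (X_mem_grading i') hx) (awayCoord k f c)).symm
  have hval (f c i' : Fin (r + 1))
      (hx : (MvPolynomial.X j * MvPolynomial.X i : MvPolynomial (Fin (r + 1)) k) =
        MvPolynomial.X f * MvPolynomial.X i') :
      (HomogeneousLocalization.awayMap (grading k r) (X_mem_grading i') hx
        (awayCoord k f c)).val = Localization.mk
          (S := .powers (MvPolynomial.X j * MvPolynomial.X i : MvPolynomial (Fin (r + 1)) k))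
          (MvPolynomial.X c * MvPolynomial.X i' ^ 1)
          ⟨(MvPolynomial.X j * MvPolynomial.X i) ^ 1, 1, rfl⟩ :=
    HomogeneousLocalization.val_awayMap_mk ..
  rw [hres j b i rfl hVj, hres j i i rfl hVj, hres i b j (mul_comm _ _) hVi, ← map_mul, ← map_mul]
  congr 2
  refine HomogeneousLocalization.val_injective _ ?_
  rw [HomogeneousLocalization.val_mul, hval, hval, hval, Localization.mk_mul,
    Localization.mk_eq_mk_iff]
  refine Localization.r_of_eq ?_
  simp only [Submonoid.coe_mul]
  ring

/-- The ring homomorphism `F ↦ F(v)` on functions of the chart `x_j ≠ 0`, if `v_j = 1`. -/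
def awayEval {L : Type u} [CommRing L] (a : k →+* L) (v : Fin (r + 1) → L) (j : Fin (r + 1))
    (hv : v j = 1) : HomogeneousLocalization.Away (grading k r) (MvPolynomial.X j) →+* L :=
  (Localization.awayLift (MvPolynomial.eval₂Hom a v) (MvPolynomial.X j) (by simp [hv])).comp
    (algebraMap (HomogeneousLocalization.Away (grading k r) (MvPolynomial.X j))
      (Localization.Away (MvPolynomial.X j : MvPolynomial (Fin (r + 1)) k)))

theorem awayEval_mk {L : Type u} [CommRing L] (a : k →+* L) (v : Fin (r + 1) → L) (j : Fin (r + 1))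
    (hv : v j = 1) (m : ℕ) (F : MvPolynomial (Fin (r + 1)) k) (hF) :
    awayEval a v j hv (HomogeneousLocalization.Away.mk (grading k r) (d := 1)
      (X_mem_grading j) m F hF) = MvPolynomial.eval₂Hom a v F := by
  rw [awayEval, RingHom.comp_apply, HomogeneousLocalization.algebraMap_apply,
    HomogeneousLocalization.Away.val_mk, Localization.awayLift_mk (v := 1) (hv := by simp [hv])]
  simp

/-- The point `[v₀ : … : v_r]` of `ℙ^r`, if `v_j = 1`. -/
def pointOfCoords {L : Type u} [Field L] (a : k →+* L) (v : Fin (r + 1) → L) (j : Fin (r + 1))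
    (hv : v j = 1) : Spec (CommRingCat.of L) ⟶ PP k r :=
  Spec.map (CommRingCat.ofHom (awayEval a v j hv)) ≫
    Proj.awayι (grading k r) (MvPolynomial.X j) (X_mem_grading j) zero_lt_one

theorem pointOfCoords_toSpec {L : Type u} [Field L] (a : k →+* L) (v : Fin (r + 1) → L)
    (j : Fin (r + 1)) (hv : v j = 1) :
    pointOfCoords a v j hv ≫ PP.toSpec k r = Spec.map (CommRingCat.ofHom a) := by
  rw [pointOfCoords, PP.toSpec, Category.assoc, Proj.awayι_toSpecZero_assoc, ← Spec.map_comp,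
    ← Spec.map_comp]
  congr 1
  ext x
  change awayEval a v j hv (HomogeneousLocalization.fromZeroRingHom _ _ _) = a x
  rw [awayEval, RingHom.comp_apply, HomogeneousLocalization.algebraMap_apply]
  change Localization.awayLift _ _ _ (Localization.mk (MvPolynomial.C x) 1) = a x
  rw [Localization.mk_one_eq_algebraMap, IsLocalization.Away.lift_eq]
  simp

theorem pointOfCoords_mem_chart {L : Type u} [Field L] (a : k →+* L) (v : Fin (r + 1) → L)
    (j : Fin (r + 1)) (hv : v j = 1) : ⊤ ≤ pointOfCoords a v j hv ⁻¹ᵁ PP.chart k j := by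
  intro z _
  change _ ∈ PP.chart k j
  rw [PP.chart, ← Proj.opensRange_awayι (grading k r) _ (X_mem_grading j) zero_lt_one]
  exact ⟨_, rfl⟩

/-- The chart inclusion is built from the inverse of the isomorphism from the chart to its spectrum,
and that isomorphism induces `awayToSection` on functions. -/
theorem evalAt_awayι (j : Fin (r + 1)) (h)
    (z : HomogeneousLocalization.Away (grading k r) (MvPolynomial.X j)) :
    evalAt (Proj.awayι (grading k r) (MvPolynomial.X j) (X_mem_grading j) zero_lt_one)
      (PP.chart k j) h
      ((Proj.awayToSection (grading k r) (MvPolynomial.X j)).hom z) = z := by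
  set e := Proj.basicOpenIsoSpec (grading k r) (MvPolynomial.X j) (X_mem_grading j) zero_lt_one
    with he
  have h₁ : (Proj.awayι (grading k r) (MvPolynomial.X j) (X_mem_grading j) zero_lt_one).appLE
      (PP.chart k j) ⊤ h = (PP.chart k j).topIso.inv ≫ e.inv.appTop := by
    change (e.inv ≫ (PP.chart k j).ι).appLE _ _ _ = _
    rw [← Scheme.Hom.appLE_comp_appLE e.inv (PP.chart k j).ι (PP.chart k j) ⊤ ⊤
      (PP.chart k j).ι_preimage_self.ge le_top]
    congr 1
  have h₂ := Proj.basicOpenToSpec_app_top (grading k r) (MvPolynomial.X j)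
  have h₃ : e.hom.appTop ≫ e.inv.appTop = 𝟙 _ := by
    rw [← Scheme.Hom.comp_appTop, e.inv_hom_id, Scheme.Hom.id_appTop]
  have h₄ : Proj.awayToSection (grading k r) (MvPolynomial.X j) ≫
      (PP.chart k j).topIso.inv ≫ e.inv.appTop ≫ (Scheme.ΓSpecIso _).hom = 𝟙 _ := by
    rw [← cancel_epi (Scheme.ΓSpecIso _).hom, ← Category.assoc _ (Scheme.Opens.topIso _).inv,
      ← Category.assoc, ← h₂]
    change e.hom.appTop ≫ _ = _
    rw [← Category.assoc, h₃, Category.id_comp, Category.comp_id]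
  rw [evalAt, h₁]
  exact ConcreteCategory.congr_hom h₄ z

theorem evalAt_pointOfCoords {L : Type u} [Field L] (a : k →+* L) (v : Fin (r + 1) → L)
    (j b : Fin (r + 1)) (hv : v j = 1) :
    evalAt (pointOfCoords a v j hv) (PP.chart k j) (pointOfCoords_mem_chart a v j hv)
      (PP.coord k j b) = v b := by
  simp only [pointOfCoords, coord_eq]
  rw [evalAt_specMap_comp _ _ _ (by
    intro z _
    change _ ∈ PP.chart k j
    rw [PP.chart, ← Proj.opensRange_awayι (grading k r) _ (X_mem_grading j) zero_lt_one]
    exact ⟨_, rfl⟩), evalAt_awayι, awayCoord, awayEval_mk]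
  simp

end NormPencil

end

/-! ### The function field of `ℙ¹` -/

noncomputable section
namespace NormPencil

theorem eval₂Hom_mul_of_isHomogeneous {R S σ : Type*} [CommRing R] [CommRing S] (a : R →+* S)
    (c : S) (w : σ → S) {F : MvPolynomial σ R} {m : ℕ} (hF : F.IsHomogeneous m) :
    MvPolynomial.eval₂Hom a (fun i => c * w i) F = c ^ m * MvPolynomial.eval₂Hom a w F := by
  simp only [MvPolynomial.coe_eval₂Hom, MvPolynomial.eval₂_eq, Finset.mul_sum]
  refine Finset.sum_congr rfl fun s hs => ?_
  have hs' : ∑ i ∈ s.support, s i = m := by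
    rw [hF.degree_eq_sum_deg_support hs]
  simp only [mul_pow, Finset.prod_mul_distrib, Finset.prod_pow_eq_pow_sum, hs']
  ring

variable {k : Type u} [Field k]

theorem eval₂Hom_eq_aeval_dehomogenization {E : Type*} [Field E] [Algebra k E] {w : Fin 2 → E}
    (hw : w 1 = 1) (F : MvPolynomial (Fin 2) k) :
    MvPolynomial.eval₂Hom (algebraMap k E) w F =
      Polynomial.aeval (w 0) (MvPolynomial.aeval ![(Polynomial.X : k[X]), 1] F) := by
  rw [← AlgHom.comp_apply, MvPolynomial.comp_aeval, MvPolynomial.coe_eval₂Hom,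
    MvPolynomial.aeval_def]
  congr 1
  ext i
  fin_cases i <;> simp [hw]

/-- A form `F` of degree `m` equals `x₁ ^ m F(x₀ / x₁, 1)`. If `F(t, 1) = 0` for a transcendental
`t`, the one-variable polynomial `F(X, 1)` vanishes, and with it `F`. -/
theorem awayEval_injective {L : Type u} [Field L] [Algebra k L] {v : Fin 2 → L} (hv : v 1 = 1)
    (ht : Transcendental k (v 0)) :
    Function.Injective (awayEval (r := 1) (algebraMap k L) v 1 hv) := by
  rw [injective_iff_map_eq_zero]
  intro z hz
  obtain ⟨m, F, hF, rfl⟩ := HomogeneousLocalization.Away.mk_surjective (grading k 1)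
    (X_mem_grading 1) z
  rw [awayEval_mk, eval₂Hom_eq_aeval_dehomogenization hv] at hz
  have hp0 := (transcendental_iff.1 ht) _ hz
  have hF0 : F = 0 := by
    let E := FractionRing (MvPolynomial (Fin 2) k)
    let x (i : Fin 2) : E := algebraMap (MvPolynomial (Fin 2) k) E (MvPolynomial.X i)
    have hX1 : x 1 ≠ 0 := by simp [x]
    let w : Fin 2 → E := ![x 0 / x 1, 1]
    have h := eval₂Hom_mul_of_isHomogeneous (algebraMap k E) (x 1) w hF
    rw [eval₂Hom_eq_aeval_dehomogenization (w := w) rfl, hp0, map_zero, mul_zero] at h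
    refine (IsFractionRing.injective (MvPolynomial (Fin 2) k) E) ?_
    rw [map_zero, ← h]
    have hx : (fun i => x 1 * w i) = x := by
      ext i
      fin_cases i
      · exact mul_div_cancel₀ _ hX1
      · exact mul_one _
    rw [hx]
    have h2 : MvPolynomial.eval₂Hom (algebraMap k E) x =
        algebraMap (MvPolynomial (Fin 2) k) E := by
      ext i
      · simp [IsScalarTower.algebraMap_apply k (MvPolynomial (Fin 2) k) E]
      · simp [x]
    exact (RingHom.congr_fun h2 F).symm
  refine HomogeneousLocalization.val_injective _ ?_
  rw [HomogeneousLocalization.Away.val_mk, hF0, HomogeneousLocalization.val_zero,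
    Localization.mk_zero]

/-- Injectivity on functions makes the map to the chart dominant, and the chart is dense in `ℙ¹`.
The image is thus a single point with dense closure. -/
theorem pointOfCoords_eq_genericPoint {L : Type u} [Field L] [Algebra k L] {v : Fin 2 → L}
    (hv : v 1 = 1) (ht : Transcendental k (v 0)) (z : Spec (CommRingCat.of L)) :
    pointOfCoords (r := 1) (algebraMap k L) v 1 hv z = genericPoint (PP k 1) := by
  have h₁ : DenseRange (Spec.map (CommRingCat.ofHom
      (awayEval (r := 1) (algebraMap k L) v 1 hv))) := by
    refine PrimeSpectrum.denseRange_comap_iff_ker_le_nilRadical _ |>.2 ?_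
    rw [CommRingCat.hom_ofHom, (RingHom.injective_iff_ker_eq_bot _).1 (awayEval_injective hv ht)]
    exact bot_le
  have h₂ : DenseRange (Proj.awayι (grading k 1) (MvPolynomial.X 1) (X_mem_grading 1)
      zero_lt_one) :=
    (Scheme.Hom.isOpenEmbedding _).isOpen_range.dense ⟨_, Spec.map (CommRingCat.ofHom
      (awayEval (r := 1) (algebraMap k L) v 1 hv)) z, rfl⟩
  have h : DenseRange (pointOfCoords (r := 1) (algebraMap k L) v 1 hv) :=
    h₂.comp h₁ (Scheme.Hom.continuous _)
  have hr : Set.range (pointOfCoords (r := 1) (algebraMap k L) v 1 hv) =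
      {pointOfCoords (r := 1) (algebraMap k L) v 1 hv z} := by
    ext y
    simp only [Set.mem_range, Set.mem_singleton_iff]
    constructor
    · rintro ⟨w, rfl⟩; rw [Subsingleton.elim w z]
    · rintro rfl; exact ⟨z, rfl⟩
  have hgen : IsGenericPoint (pointOfCoords (r := 1) (algebraMap k L) v 1 hv z) ⊤ := by
    rw [IsGenericPoint, ← hr]
    exact h.closure_range
  exact hgen.eq (genericPoint_spec _)

theorem exists_specMap_comp_fromSpecResidueField_eq {L : Type u} [Field L] {X : Scheme.{u}}
    (g : Spec (CommRingCat.of L) ⟶ X) {x : X} (z : Spec (CommRingCat.of L)) (hx : g z = x) :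
    ∃ a : X.residueField x →+* L,
      Spec.map (CommRingCat.ofHom a) ≫ X.fromSpecResidueField x = g := by
  subst hx
  rw [Subsingleton.elim z (IsLocalRing.closedPoint L)]
  exact ⟨_, (Scheme.SpecToEquivOfField L X).left_inv g⟩

/-- The image of `a` contains the constants and the coordinate `φ`, hence all quotients of
polynomials in `φ`. -/
theorem surjective_of_specMap_comp_eq_pointOfCoords {K : Type u} [Field K] {φ : RatFunc k}
    {v : Fin 2 → k⟮φ⟯} (hv : v 1 = 1) (hv₀ : v 0 = IntermediateField.AdjoinSimple.gen k φ)
    (ψ : Spec (CommRingCat.of K) ⟶ PP k 1) (a : K →+* k⟮φ⟯)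
    (ha : Spec.map (CommRingCat.ofHom a) ≫ ψ =
      pointOfCoords (r := 1) (algebraMap k k⟮φ⟯) v 1 hv) :
    Function.Surjective a := by
  intro y
  have hmem : ⊤ ≤ (Spec.map (CommRingCat.ofHom a) ≫ ψ) ⁻¹ᵁ PP.chart k 1 := by
    rw [ha]
    exact pointOfCoords_mem_chart (r := 1) (algebraMap k k⟮φ⟯) v 1 hv
  have hη : ⊤ ≤ ψ ⁻¹ᵁ PP.chart k 1 :=
    top_le_preimage_of_mem (z := Spec.map (CommRingCat.ofHom a) (IsLocalRing.closedPoint _))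
      (hmem (show IsLocalRing.closedPoint _ ∈ ⊤ from trivial))
  obtain ⟨b, hb⟩ := Spec.map_surjective (ψ ≫ PP.toSpec k 1)
  have hab : a.comp b.hom = algebraMap k k⟮φ⟯ := by
    have h := pointOfCoords_toSpec (r := 1) (algebraMap k k⟮φ⟯) v 1 hv
    rw [← ha, Category.assoc, ← hb, ← Spec.map_comp] at h
    exact congrArg CommRingCat.Hom.hom (Spec.map_injective h)
  have hat : a (evalAt ψ (PP.chart k 1) hη (PP.coord k 1 0)) =
      IntermediateField.AdjoinSimple.gen k φ := by
    rw [← evalAt_specMap_comp a _ _ hη hmem, ← hv₀,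
      ← evalAt_pointOfCoords (r := 1) (algebraMap k k⟮φ⟯) v 1 0 hv]
    congr!
  obtain ⟨p, q, hpq⟩ := (IntermediateField.mem_adjoin_simple_iff k (y : RatFunc k)).1 y.2
  have haeval (p : k[X]) : (a (p.eval₂ b.hom (evalAt ψ (PP.chart k 1) hη (PP.coord k 1 0))) :
      RatFunc k) = Polynomial.aeval φ p := by
    rw [Polynomial.hom_eval₂, hab, hat]
    exact (Polynomial.aeval_algebraMap_apply (RatFunc k)
      (IntermediateField.AdjoinSimple.gen k φ) p).symm
  refine ⟨p.eval₂ b.hom (evalAt ψ (PP.chart k 1) hη (PP.coord k 1 0)) /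
    q.eval₂ b.hom (evalAt ψ (PP.chart k 1) hη (PP.coord k 1 0)), Subtype.ext ?_⟩
  rw [map_div₀]
  push_cast
  rw [haeval, haeval, hpq]

/-- The function field of `ℙ¹` is `k(φ)`. -/
theorem exists_residueField_equiv {φ : RatFunc k} (hφ : Transcendental k φ) {v : Fin 2 → k⟮φ⟯}
    (hv : v 1 = 1) (hv₀ : v 0 = IntermediateField.AdjoinSimple.gen k φ) :
    ∃ e : (PP k 1).residueField (genericPoint (PP k 1)) ≃+* k⟮φ⟯,
      Spec.map (CommRingCat.ofHom e.toRingHom) ≫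
        (PP k 1).fromSpecResidueField (genericPoint (PP k 1)) =
      pointOfCoords (r := 1) (algebraMap k k⟮φ⟯) v 1 hv := by
  have ht : Transcendental k (v 0) := by
    rw [← transcendental_algebraMap_iff (algebraMap k⟮φ⟯ (RatFunc k)).injective, hv₀]
    exact hφ
  obtain ⟨a, ha⟩ := exists_specMap_comp_fromSpecResidueField_eq
    (pointOfCoords (r := 1) (algebraMap k k⟮φ⟯) v 1 hv) (IsLocalRing.closedPoint _)
    (pointOfCoords_eq_genericPoint hv ht _)
  exact ⟨RingEquiv.ofBijective a ⟨a.injective,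
    surjective_of_specMap_comp_eq_pointOfCoords hv hv₀ _ a ha⟩, ha⟩

end NormPencil

end

/-! ### The ideal sheaf of the hypersurface and its points -/

noncomputable section
namespace NormPencil

section idealSheaf

variable {X : Scheme.{u}}

/-- A product of ideal sheaves is contained in the intersection, and its support is the union of the
supports. Finiteness of `ι` permits the induction. -/
theorem mem_support_iInf_of_finite {ι : Type*} [Finite ι] (I : ι → X.IdealSheafData) {x : X}
    (hx : x ∈ (⨅ i, I i).support) : ∃ i, x ∈ (I i).support := by
  classical
  have := Fintype.ofFinite ι
  have key (s : Finset ι) : x ∈ (s.inf I).support → ∃ i, x ∈ (I i).support := by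
    induction s using Finset.induction_on with
    | empty =>
      intro h
      rw [Finset.inf_empty, Scheme.IdealSheafData.support_top] at h
      exact h.elim
    | insert a s _ ih =>
      intro h
      rw [Finset.inf_insert] at h
      have hle : I a * s.inf I ≤ I a ⊓ s.inf I := fun U => Ideal.mul_le_inf
      have h' := Scheme.IdealSheafData.support_antitone hle h
      rw [Scheme.IdealSheafData.support_mul] at h'
      exact h'.elim (fun h => ⟨a, h⟩) ih
  exact key Finset.univ (by rwa [Finset.inf_univ_eq_iInf])

theorem ofIdealTop_le_ker {Y : Scheme.{u}} (f : Y ⟶ X) {J : Ideal Γ(X, ⊤)}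
    (h : J ≤ RingHom.ker f.appTop.hom) : Scheme.IdealSheafData.ofIdealTop J ≤ f.ker := by
  refine Scheme.IdealSheafData.le_ofIdeals_iff.mpr fun U => ?_
  refine Ideal.map_le_iff_le_comap.2 (h.trans ?_)
  rw [RingHom.comap_ker, ← CommRingCat.hom_comp, f.naturality]
  intro x hx
  rw [RingHom.mem_ker] at hx ⊢
  rw [CommRingCat.hom_comp, RingHom.comp_apply]
  exact (congrArg _ hx).trans (map_zero _)

end idealSheaf

variable {k : Type u} [Field k]

instance PP.compactSpace (r : ℕ) : CompactSpace (PP k r) := by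
  rw [← isCompact_univ_iff]
  have h : (Set.univ : Set (PP k r)) = ⋃ j : Fin (r + 1), (PP.chart k j : Set (PP k r)) := by
    rw [← TopologicalSpace.Opens.coe_iSup, iSup_chart]; rfl
  rw [h]
  exact isCompact_iUnion fun j =>
    (Proj.isAffineOpen_basicOpen _ _ (X_mem_grading j) zero_lt_one).isCompact

instance PP.quasiCompact_toSpec (r : ℕ) : QuasiCompact (PP.toSpec k r) :=
  inferInstance

instance P1xPn.isSeparated (n : ℕ) : (P1xPn k n).IsSeparated := by
  have h : IsSeparated (P1xPn.fst k n ≫ PP.toSpec k 1) := inferInstance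
  constructor
  rw [← terminal.comp_from (P1xPn.fst k n ≫ PP.toSpec k 1)]
  infer_instance

/-- Used to compute the support of an ideal sheaf pushed forward from a chart as a closure. A chart
is an intersection of two quasi-compact opens, which is quasi-compact because the product is
separated. -/
instance P1xPn.quasiCompact_chart_ι {n : ℕ} (c : Fin 2 × Fin (n + 1)) :
    QuasiCompact (P1xPn.chart k c).ι := by
  have h₁ : IsCompact (P1xPn.fst k n ⁻¹ᵁ PP.chart k c.1 : Set (P1xPn k n)) :=
    QuasiCompact.isCompact_preimage (f := P1xPn.fst k n) _ (PP.chart k c.1).2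
      (Proj.isAffineOpen_basicOpen _ _ (X_mem_grading c.1) zero_lt_one).isCompact
  have h₂ : IsCompact (P1xPn.snd k n ⁻¹ᵁ PP.chart k c.2 : Set (P1xPn k n)) :=
    QuasiCompact.isCompact_preimage (f := P1xPn.snd k n) _ (PP.chart k c.2).2
      (Proj.isAffineOpen_basicOpen _ _ (X_mem_grading c.2) zero_lt_one).isCompact
  have h : IsCompact (P1xPn.chart k c : Set (P1xPn k n)) :=
    QuasiSeparatedSpace.inter_isCompact _ _ (P1xPn.fst k n ⁻¹ᵁ PP.chart k c.1).2 h₁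
      (P1xPn.snd k n ⁻¹ᵁ PP.chart k c.2).2 h₂
  have : CompactSpace (P1xPn.chart k c).toScheme := isCompact_iff_compactSpace.1 h
  infer_instance

theorem P1xPn.exists_mem_chart {n : ℕ} (y : P1xPn k n) {i : Fin 2}
    (hi : P1xPn.fst k n y ∈ PP.chart k i) : ∃ j : Fin (n + 1), y ∈ P1xPn.chart k (i, j) := by
  have h : P1xPn.snd k n y ∈ ⨆ j : Fin (n + 1), PP.chart k j := by rw [iSup_chart]; trivial
  obtain ⟨j, hj⟩ := TopologicalSpace.Opens.mem_iSup.1 h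
  exact ⟨j, hi, hj⟩

section points

variable {n : ℕ} {L : Type u}

theorem evalAt_ΓSpecIso_inv {R : Type u} [CommRing R] [CommRing L] (b : R →+* L)
    (f : Spec (CommRingCat.of L) ⟶ Spec (CommRingCat.of R))
    (hb : f = Spec.map (CommRingCat.ofHom b)) (h : ⊤ ≤ f ⁻¹ᵁ ⊤) (x : R) :
    evalAt f ⊤ h ((Scheme.ΓSpecIso (CommRingCat.of R)).inv x) = b x := by
  subst hb
  have e : (Scheme.ΓSpecIso (CommRingCat.of R)).inv ≫
      (Spec.map (CommRingCat.ofHom b)).appLE ⊤ ⊤ h ≫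
      (Scheme.ΓSpecIso (CommRingCat.of L)).hom = CommRingCat.ofHom b := by
    have e₁ : (Spec.map (CommRingCat.ofHom b)).appLE ⊤ ⊤ h =
        (Spec.map (CommRingCat.ofHom b)).appTop := by
      simp [Scheme.Hom.appTop, Scheme.Hom.app_eq_appLE]
    rw [e₁, Scheme.ΓSpecIso_naturality, Iso.inv_hom_id_assoc]
  exact ConcreteCategory.congr_hom e x

theorem evalAt_dehomogenize [CommRing L] (f : Spec (CommRingCat.of L) ⟶ P1xPn k n) (b : k →+* L)
    (hb : f ≫ P1xPn.fst k n ≫ PP.toSpec k 1 = Spec.map (CommRingCat.ofHom b))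
    (c : Fin 2 × Fin (n + 1)) (h : ⊤ ≤ f ⁻¹ᵁ P1xPn.chart k c)
    (h₁ : ⊤ ≤ (f ≫ P1xPn.fst k n) ⁻¹ᵁ PP.chart k c.1)
    (h₂ : ⊤ ≤ (f ≫ P1xPn.snd k n) ⁻¹ᵁ PP.chart k c.2) :
    (evalAt f _ h).comp (P1xPn.dehomogenize k c) = MvPolynomial.eval₂Hom b
      (Sum.elim (fun i => evalAt (f ≫ P1xPn.fst k n) _ h₁ (PP.coord k c.1 i))
        (fun i => evalAt (f ≫ P1xPn.snd k n) _ h₂ (PP.coord k c.2 i))) := by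
  have hC (x : k) : evalAt f _ h (((Scheme.ΓSpecIso (CommRingCat.of k)).inv ≫
      (P1xPn.fst k n ≫ PP.toSpec k 1).appLE ⊤ (P1xPn.chart k c) le_top).hom x) = b x := by
    refine (evalAt_comp f (P1xPn.fst k n ≫ PP.toSpec k 1) ⊤ _ le_top h _).trans ?_
    exact evalAt_ΓSpecIso_inv b _ hb _ x
  refine MvPolynomial.ringHom_ext (fun x => ?_) (fun v => ?_)
  · rw [RingHom.comp_apply, P1xPn.dehomogenize, MvPolynomial.eval₂Hom_C, MvPolynomial.eval₂Hom_C]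
    exact hC x
  · rw [RingHom.comp_apply, P1xPn.dehomogenize, MvPolynomial.eval₂Hom_X', MvPolynomial.eval₂Hom_X']
    cases v with
    | inl i => exact evalAt_comp ..
    | inr i => exact evalAt_comp ..

theorem evalAt_dehomogenize_normForm_eq_zero [Field L] {φ : RatFunc k} {d : ℕ}
    {G : Module.Basis (Fin (n + 1)) k (Polynomial.degreeLT k (n + 1))}
    (f : Spec (CommRingCat.of L) ⟶ P1xPn k n) (c c' : Fin 2 × Fin (n + 1))
    (h : ⊤ ≤ f ⁻¹ᵁ P1xPn.chart k c) (h' : ⊤ ≤ f ⁻¹ᵁ P1xPn.chart k c')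
    (h0 : evalAt f _ h (P1xPn.dehomogenize k c (normForm φ G d)) = 0) :
    evalAt f _ h' (P1xPn.dehomogenize k c' (normForm φ G d)) = 0 := by
  obtain ⟨b, hb⟩ := Spec.map_surjective (f ≫ P1xPn.fst k n ≫ PP.toSpec k 1)
  have h₁ : ⊤ ≤ (f ≫ P1xPn.fst k n) ⁻¹ᵁ PP.chart k c.1 := h.trans (f.preimage_mono inf_le_left)
  have h₂ : ⊤ ≤ (f ≫ P1xPn.snd k n) ⁻¹ᵁ PP.chart k c.2 := h.trans (f.preimage_mono inf_le_right)
  have h₁' : ⊤ ≤ (f ≫ P1xPn.fst k n) ⁻¹ᵁ PP.chart k c'.1 :=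
    h'.trans (f.preimage_mono inf_le_left)
  have h₂' : ⊤ ≤ (f ≫ P1xPn.snd k n) ⁻¹ᵁ PP.chart k c'.2 :=
    h'.trans (f.preimage_mono inf_le_right)
  have e := evalAt_dehomogenize f b.hom hb.symm c h h₁ h₂
  have e' := evalAt_dehomogenize f b.hom hb.symm c' h' h₁' h₂'
  have := map_normForm_eq_mul G ((evalAt f _ h).comp (P1xPn.dehomogenize k c)) φ d
    ((evalAt f _ h').comp (P1xPn.dehomogenize k c'))
    (by rw [e, e']; ext; simp)
    (evalAt (f ≫ P1xPn.fst k n) _ h₁' (PP.coord k c'.1 c.1))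
    (evalAt (f ≫ P1xPn.snd k n) _ h₂' (PP.coord k c'.2 c.2))
    (fun i => by
      rw [e, e', MvPolynomial.eval₂Hom_X', MvPolynomial.eval₂Hom_X']
      exact evalAt_coord ..)
    (fun i => by
      rw [e, e', MvPolynomial.eval₂Hom_X', MvPolynomial.eval₂Hom_X']
      exact evalAt_coord ..)
  rw [RingHom.comp_apply, RingHom.comp_apply, h0, mul_zero] at this
  exact this

theorem topIso_inv_eq_appLE {X : Scheme.{u}} (U : X.Opens) :
    U.topIso.inv = U.ι.appLE U ⊤ U.ι_preimage_self.ge := by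
  rw [Scheme.Hom.appLE, Scheme.Opens.ι_app]
  exact (X.presheaf.map_comp _ _)

/-- Vanishing at `y` is tested on the residue field of `y`, where bihomogeneity makes it independent
of the chart. -/
theorem mem_basicOpen_of_mem_basicOpen {φ : RatFunc k} {d : ℕ}
    {G : Module.Basis (Fin (n + 1)) k (Polynomial.degreeLT k (n + 1))}
    {c c' : Fin 2 × Fin (n + 1)} {y : P1xPn k n} (hy' : y ∈ P1xPn.chart k c')
    (hy : y ∈ (P1xPn k n).basicOpen (P1xPn.dehomogenize k c (normForm φ G d))) :
    y ∈ (P1xPn k n).basicOpen (P1xPn.dehomogenize k c' (normForm φ G d)) := by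
  have hc : y ∈ P1xPn.chart k c := (P1xPn k n).basicOpen_le _ hy
  have key {L : Type u} [Field L] (f : Spec (CommRingCat.of L) ⟶ P1xPn k n)
      (hf : ∀ z, f z = y) : y ∈ (P1xPn k n).basicOpen
        (P1xPn.dehomogenize k c' (normForm φ G d)) := by
    let z : Spec (CommRingCat.of L) := IsLocalRing.closedPoint L
    rw [← hf z] at hy hc hy' ⊢
    by_contra h
    refine (evalAt_eq_zero_iff f _ (top_le_preimage_of_mem hc) _ z).1 ?_ hy
    exact evalAt_dehomogenize_normForm_eq_zero f c' c (top_le_preimage_of_mem hy') _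
      ((evalAt_eq_zero_iff f _ _ _ z).2 h)
  exact key (L := (P1xPn k n).residueField y) ((P1xPn k n).fromSpecResidueField y)
    fun z => Scheme.fromSpecResidueField_apply y z

/-- The support is covered by the closures of the zero loci in the various charts. Such a closure
acquires no unwanted points in the chart `c`, because the nonvanishing locus there is open and, by
independence of the chart, misses the zero locus in the chart `c'`. -/
theorem notMem_basicOpen_of_mem_support {φ : RatFunc k} {d : ℕ}
    {G : Module.Basis (Fin (n + 1)) k (Polynomial.degreeLT k (n + 1))} {y : P1xPn k n}
    (hy : y ∈ (hypersurfaceIdeal k (normForm φ G d)).support) (c : Fin 2 × Fin (n + 1)) :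
    y ∉ (P1xPn k n).basicOpen (P1xPn.dehomogenize k c (normForm φ G d)) := by
  obtain ⟨c', hc'⟩ := mem_support_iInf_of_finite _ hy
  rw [Scheme.IdealSheafData.support_map] at hc'
  refine closure_minimal (t := ((P1xPn k n).basicOpen
    (P1xPn.dehomogenize k c (normForm φ G d)) : Set (P1xPn k n))ᶜ) ?_
    (Scheme.basicOpen _ _).2.isClosed_compl hc'
  rintro _ ⟨w, hw, rfl⟩ hmem
  have h := mem_basicOpen_of_mem_basicOpen (c' := c') w.2 hmem
  rw [SetLike.mem_coe, ← SetLike.mem_coe, Scheme.IdealSheafData.coe_support_ofIdealTop,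
    Scheme.mem_zeroLocus_iff] at hw
  refine hw _ (Ideal.subset_span rfl) ?_
  rw [topIso_inv_eq_appLE]
  exact (Scheme.basicOpen_appLE ..).ge ⟨trivial, h⟩

/-- One chart suffices here, since the ideal is an intersection and so lies in its `c`-th term; `f`
factors through that chart. -/
theorem hypersurfaceIdeal_le_ker [CommRing L] {F : MvPolynomial (Fin 2 ⊕ Fin (n + 1)) k}
    (f : Spec (CommRingCat.of L) ⟶ P1xPn k n) (c : Fin 2 × Fin (n + 1))
    (h : ⊤ ≤ f ⁻¹ᵁ P1xPn.chart k c) (h0 : evalAt f _ h (P1xPn.dehomogenize k c F) = 0) :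
    hypersurfaceIdeal k F ≤ f.ker := by
  have hr : Set.range f ⊆ Set.range (P1xPn.chart k c).ι := by
    rw [Scheme.Opens.range_ι]
    rintro _ ⟨z, rfl⟩
    exact h (show z ∈ ⊤ from trivial)
  set f' := IsOpenImmersion.lift (P1xPn.chart k c).ι f hr with hf'
  have hf : f' ≫ (P1xPn.chart k c).ι = f := IsOpenImmersion.lift_fac ..
  have h1 : f.appLE (P1xPn.chart k c) ⊤ h =
      (P1xPn.chart k c).topIso.inv ≫ f'.appTop := by
    simp only [← hf]
    rw [← Scheme.Hom.appLE_comp_appLE f' (P1xPn.chart k c).ι (P1xPn.chart k c) ⊤ ⊤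
      (P1xPn.chart k c).ι_preimage_self.ge le_top, ← topIso_inv_eq_appLE]
    simp [Scheme.Hom.appTop, Scheme.Hom.app_eq_appLE]
  refine (iInf_le _ c).trans ?_
  rw [← hf, Scheme.Hom.ker_comp]
  refine Scheme.IdealSheafData.map_mono _ (ofIdealTop_le_ker f' ?_)
  rw [Ideal.span_le, Set.singleton_subset_iff]
  rw [evalAt, h1] at h0
  refine (ConcreteCategory.bijective_of_isIso (Scheme.ΓSpecIso (CommRingCat.of L)).hom).1 ?_
  exact h0.trans (map_zero _).symm

end points

end NormPencil

end

/-! ### Points of the generic fibre of `π` -/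

noncomputable section
namespace NormPencil

variable {k : Type u} [Field k]

theorem evalAt_congr {L : Type u} [CommRing L] {X : Scheme.{u}}
    {f g : Spec (CommRingCat.of L) ⟶ X} (hfg : f = g) (U : X.Opens) (hf : ⊤ ≤ f ⁻¹ᵁ U)
    (hg : ⊤ ≤ g ⁻¹ᵁ U) (s : Γ(X, U)) : evalAt f U hf s = evalAt g U hg s := by
  subst hfg; rfl

section points

variable {d n : ℕ} {φ : RatFunc k}
  {G : Module.Basis (Fin (n + 1)) k (Polynomial.degreeLT k (n + 1))}
  {v : Fin 2 → k⟮φ⟯} (hv : v 1 = 1)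

/-- In a chart `u₁ ≠ 0`, `x_j ≠ 0` containing the point, its coordinates are `u = (φ, 1)` and some
`x` with `x_j = 1`. They annihilate the norm form, so the algebraic result applies. -/
theorem exists_choose_dvd_finrank_of_point (hd : 0 < d)
    (hφ : Module.finrank k⟮φ⟯ (RatFunc k) = d) (hGal : HasSymmetricGaloisGroup φ d)
    (hv₀ : v 0 = IntermediateField.AdjoinSimple.gen k φ)
    {L : Type u} [Field L] [Algebra k⟮φ⟯ L] (f : Spec (CommRingCat.of L) ⟶ pencil φ G d)
    (hf : f ≫ pencil.π φ G d = Spec.map (CommRingCat.ofHom (algebraMap k⟮φ⟯ L)) ≫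
      pointOfCoords (r := 1) (algebraMap k k⟮φ⟯) v 1 hv) :
    ∃ j ∈ Finset.Icc 1 (min d n), d.choose j ∣ Module.finrank k⟮φ⟯ L := by
  set g := f ≫ (hypersurfaceIdeal k (normForm φ G d)).subschemeι with hg
  have hgf : g ≫ P1xPn.fst k n = Spec.map (CommRingCat.ofHom (algebraMap k⟮φ⟯ L)) ≫
      pointOfCoords (r := 1) (algebraMap k k⟮φ⟯) v 1 hv := by
    rw [← hf, hg, Category.assoc]
  have h₁' : ⊤ ≤ (Spec.map (CommRingCat.ofHom (algebraMap k⟮φ⟯ L)) ≫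
      pointOfCoords (r := 1) (algebraMap k k⟮φ⟯) v 1 hv) ⁻¹ᵁ PP.chart k 1 := fun z _ =>
    pointOfCoords_mem_chart (r := 1) (algebraMap k k⟮φ⟯) v 1 hv
      (show Spec.map (CommRingCat.ofHom (algebraMap k⟮φ⟯ L)) z ∈ ⊤ from trivial)
  have h₁ : ⊤ ≤ (g ≫ P1xPn.fst k n) ⁻¹ᵁ PP.chart k 1 := by rw [hgf]; exact h₁'
  let z : Spec (CommRingCat.of L) := IsLocalRing.closedPoint L
  obtain ⟨j, hj⟩ := P1xPn.exists_mem_chart (g z) (h₁ (show z ∈ ⊤ from trivial))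
  have hc : ⊤ ≤ g ⁻¹ᵁ P1xPn.chart k (1, j) := top_le_preimage_of_mem hj
  have h₂ : ⊤ ≤ (g ≫ P1xPn.snd k n) ⁻¹ᵁ PP.chart k j := hc.trans (g.preimage_mono inf_le_right)
  have hz : g z ∈ (hypersurfaceIdeal k (normForm φ G d)).support := by
    rw [← SetLike.mem_coe, ← Scheme.IdealSheafData.range_subschemeι]
    exact ⟨f z, rfl⟩
  have h0 := (evalAt_eq_zero_iff g _ hc _ z).2 (notMem_basicOpen_of_mem_support hz (1, j))
  have hb : g ≫ P1xPn.fst k n ≫ PP.toSpec k 1 =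
      Spec.map (CommRingCat.ofHom ((algebraMap k⟮φ⟯ L).comp (algebraMap k k⟮φ⟯))) := by
    rw [← Category.assoc, hgf, Category.assoc, pointOfCoords_toSpec, ← Spec.map_comp]
    rfl
  have e := evalAt_dehomogenize g _ hb (1, j) hc h₁ h₂
  refine exists_choose_dvd_finrank_of_map_normForm_eq_zero (i := j)
    ((evalAt g _ hc).comp (P1xPn.dehomogenize k (1, j))) hd hφ hGal G ?_ ?_ ?_ ?_ h0
  · rw [e]; ext; simp
  · rw [e, MvPolynomial.eval₂Hom_X']
    exact (congrArg _ (coord_self 1)).trans (map_one _)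
  · rw [e, MvPolynomial.eval₂Hom_X']
    refine (evalAt_congr hgf _ _ h₁' _).trans ?_
    rw [evalAt_specMap_comp _ _ _ (pointOfCoords_mem_chart (r := 1) _ v 1 hv), ← hv₀]
    exact congrArg _ (evalAt_pointOfCoords ..)
  · rw [e, MvPolynomial.eval₂Hom_X']
    exact fun h => one_ne_zero (((congrArg _ (coord_self j)).trans (map_one _)).symm.trans h)

theorem exists_ratFunc_point (hd : 0 < d) (hn : 0 < n)
    (hφ : Module.finrank k⟮φ⟯ (RatFunc k) = d)
    (hv₀ : v 0 = IntermediateField.AdjoinSimple.gen k φ) :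
    ∃ f : Spec (CommRingCat.of (RatFunc k)) ⟶ pencil φ G d,
      f ≫ pencil.π φ G d = Spec.map (CommRingCat.ofHom (algebraMap k⟮φ⟯ (RatFunc k))) ≫
        pointOfCoords (r := 1) (algebraMap k k⟮φ⟯) v 1 hv := by
  obtain ⟨x, hx, hx0⟩ := exists_map_normForm_eq_zero hd hn hφ G
  obtain ⟨j, hj⟩ := Function.ne_iff.1 hx
  -- The solution is rescaled so that its `j`-th coordinate is `1`, as `pointOfCoords` requires;
  -- bihomogeneity keeps the norm form zero.
  set w : Fin (n + 1) → RatFunc k := fun i => (x j)⁻¹ * x i with hw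
  have hwj : w j = 1 := inv_mul_cancel₀ hj
  set g₁ := Spec.map (CommRingCat.ofHom (algebraMap k⟮φ⟯ (RatFunc k))) ≫
        pointOfCoords (r := 1) (algebraMap k k⟮φ⟯) v 1 hv with hg₁
  set g₂ := pointOfCoords (algebraMap k (RatFunc k)) w j hwj with hg₂
  have hb₁ : g₁ ≫ PP.toSpec k 1 = Spec.map (CommRingCat.ofHom (algebraMap k (RatFunc k))) := by
    rw [hg₁, Category.assoc, pointOfCoords_toSpec, ← Spec.map_comp]
    rfl
  have hb₂ : g₂ ≫ PP.toSpec k n = Spec.map (CommRingCat.ofHom (algebraMap k (RatFunc k))) :=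
    pointOfCoords_toSpec ..
  set g : Spec (CommRingCat.of (RatFunc k)) ⟶ P1xPn k n :=
    pullback.lift g₁ g₂ (hb₁.trans hb₂.symm) with hg
  have hgf : g ≫ P1xPn.fst k n = g₁ := pullback.lift_fst ..
  have hgs : g ≫ P1xPn.snd k n = g₂ := pullback.lift_snd ..
  have h₁' : ⊤ ≤ g₁ ⁻¹ᵁ PP.chart k 1 := fun z _ =>
    pointOfCoords_mem_chart (r := 1) (algebraMap k k⟮φ⟯) v 1 hv
      (show Spec.map (CommRingCat.ofHom (algebraMap k⟮φ⟯ (RatFunc k))) z ∈ ⊤ from trivial)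
  have h₂' : ⊤ ≤ g₂ ⁻¹ᵁ PP.chart k j := pointOfCoords_mem_chart ..
  have h₁ : ⊤ ≤ (g ≫ P1xPn.fst k n) ⁻¹ᵁ PP.chart k 1 := by rw [hgf]; exact h₁'
  have h₂ : ⊤ ≤ (g ≫ P1xPn.snd k n) ⁻¹ᵁ PP.chart k j := by rw [hgs]; exact h₂'
  have hc : ⊤ ≤ g ⁻¹ᵁ P1xPn.chart k (1, j) := fun z _ => ⟨h₁ trivial, h₂ trivial⟩
  have e := evalAt_dehomogenize g _ (by rw [← Category.assoc, hgf, hb₁]) (1, j) hc h₁ h₂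
  have hcoord₁ (i) : evalAt (g ≫ P1xPn.fst k n) _ h₁ (PP.coord k 1 i) =
      algebraMap k⟮φ⟯ (RatFunc k) (v i) := by
    rw [evalAt_congr hgf _ _ h₁']
    simp only [hg₁]
    rw [evalAt_specMap_comp _ _ _ (pointOfCoords_mem_chart (r := 1) _ v 1 hv),
      evalAt_pointOfCoords]
  have hcoord₂ (i) : evalAt (g ≫ P1xPn.snd k n) _ h₂ (PP.coord k j i) = w i := by
    rw [evalAt_congr hgs _ _ h₂']
    exact evalAt_pointOfCoords ..
  have h0 : evalAt g _ hc (P1xPn.dehomogenize k (1, j) (normForm φ G d)) = 0 := by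
    have h := map_normForm_eq_mul G (MvPolynomial.eval₂Hom (algebraMap k (RatFunc k))
      (Sum.elim ![φ, 1] x)) φ d ((evalAt g _ hc).comp (P1xPn.dehomogenize k (1, j)))
      (by rw [e]; ext; simp) 1 (x j)⁻¹
      (fun i => by
        rw [e, MvPolynomial.eval₂Hom_X', MvPolynomial.eval₂Hom_X', one_mul]
        refine (hcoord₁ i).trans ?_
        fin_cases i
        · exact (congrArg _ hv₀).trans rfl
        · exact (congrArg _ hv).trans (map_one _))
      (fun i => by
        rw [e, MvPolynomial.eval₂Hom_X', MvPolynomial.eval₂Hom_X']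
        exact hcoord₂ i)
    rw [hx0, mul_zero] at h
    exact h
  have hle := hypersurfaceIdeal_le_ker g (1, j) hc h0
  refine ⟨IsClosedImmersion.lift (hypersurfaceIdeal k (normForm φ G d)).subschemeι g
    (by rwa [Scheme.IdealSheafData.ker_subschemeι]), ?_⟩
  rw [pencil.π, IsClosedImmersion.lift_fac_assoc, hgf]

variable {K : Type u} [Field K] (ψ : Spec (CommRingCat.of K) ⟶ PP k 1) (ε : K ≃+* k⟮φ⟯)

theorem exists_choose_dvd_finrank_of_equiv
    (hε : Spec.map (CommRingCat.ofHom ε.toRingHom) ≫ ψ =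
      pointOfCoords (r := 1) (algebraMap k k⟮φ⟯) v 1 hv) (hd : 0 < d)
    (hφ : Module.finrank k⟮φ⟯ (RatFunc k) = d) (hGal : HasSymmetricGaloisGroup φ d)
    (hv₀ : v 0 = IntermediateField.AdjoinSimple.gen k φ)
    {L : Type u} [Field L] [Algebra K L] (f : Spec (CommRingCat.of L) ⟶ pencil φ G d)
    (hf : f ≫ pencil.π φ G d = Spec.map (CommRingCat.ofHom (algebraMap K L)) ≫ ψ) :
    ∃ j ∈ Finset.Icc 1 (min d n), d.choose j ∣ Module.finrank K L := by
  -- `L` is made an extension of `k(φ)` through `ε`, which preserves its degree.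
  let _ : Algebra k⟮φ⟯ L := ((algebraMap K L).comp ε.symm.toRingHom).toAlgebra
  have hL : (algebraMap k⟮φ⟯ L).comp ε.toRingHom = algebraMap K L := by
    ext x
    exact congrArg (algebraMap K L) (ε.symm_apply_apply x)
  rw [Algebra.finrank_eq_of_equiv_equiv (S₀ := L) (S₁ := L) ε (RingEquiv.refl L) hL]
  refine exists_choose_dvd_finrank_of_point hv hd hφ hGal hv₀ f ?_
  rw [hf, ← hε, ← Category.assoc, ← Spec.map_comp, ← CommRingCat.ofHom_comp, hL]

theorem exists_point_finrank_eq
    (hε : Spec.map (CommRingCat.ofHom ε.toRingHom) ≫ ψ =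
      pointOfCoords (r := 1) (algebraMap k k⟮φ⟯) v 1 hv) (hd : 0 < d) (hn : 0 < n)
    (hφ : Module.finrank k⟮φ⟯ (RatFunc k) = d)
    (hv₀ : v 0 = IntermediateField.AdjoinSimple.gen k φ) :
    ∃ (L : Type u) (_ : Field L) (_ : Algebra K L), FiniteDimensional K L ∧
      Module.finrank K L = d ∧ ∃ f : Spec (CommRingCat.of L) ⟶ pencil φ G d,
        f ≫ pencil.π φ G d = Spec.map (CommRingCat.ofHom (algebraMap K L)) ≫ ψ := by
  let _ : Algebra K (RatFunc k) := ((algebraMap k⟮φ⟯ (RatFunc k)).comp ε.toRingHom).toAlgebra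
  have hrank : Module.finrank K (RatFunc k) = d := by
    rw [← hφ]
    exact Algebra.finrank_eq_of_equiv_equiv ε (RingEquiv.refl _) rfl
  obtain ⟨f, hf⟩ := exists_ratFunc_point (G := G) hv hd hn hφ hv₀
  refine ⟨RatFunc k, inferInstance, inferInstance,
    Module.finite_of_finrank_pos (hrank.symm ▸ hd), hrank, f, ?_⟩
  rw [hf, ← hε, ← Category.assoc, ← Spec.map_comp, ← CommRingCat.ofHom_comp]

end points

theorem mem_pointDegrees_fiber_iff {X B : Scheme.{u}} (π : X ⟶ B) (b : B) (e : ℕ) :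
    e ∈ pointDegrees (B.residueField b) (π.fiberToSpecResidueField b) ↔
      ∃ (L : Type u) (_ : Field L) (_ : Algebra (B.residueField b) L),
        FiniteDimensional (B.residueField b) L ∧ Module.finrank (B.residueField b) L = e ∧
        ∃ f : Spec (CommRingCat.of L) ⟶ X, f ≫ π =
          Spec.map (CommRingCat.ofHom (algebraMap (B.residueField b) L)) ≫
            B.fromSpecResidueField b := by
  constructor
  · rintro ⟨L, _, _, h, he, x, hx⟩
    refine ⟨L, _, _, h, he, x ≫ π.fiberι b, ?_⟩
    rw [Category.assoc, Scheme.Hom.fiber_fac, ← Category.assoc, hx]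
  · rintro ⟨L, _, _, h, he, f, hf⟩
    exact ⟨L, _, _, h, he, pullback.lift f _ hf, pullback.lift_snd ..⟩

section genericFibre

variable {d n : ℕ} {φ : RatFunc k}
  (G : Module.Basis (Fin (n + 1)) k (Polynomial.degreeLT k (n + 1)))

theorem exists_choose_dvd_of_mem_pointDegrees (hd : 0 < d)
    (hφ : Module.finrank k⟮φ⟯ (RatFunc k) = d) (hGal : HasSymmetricGaloisGroup φ d) {e : ℕ}
    (he : e ∈ pointDegrees ((PP k 1).residueField (genericPoint (PP k 1)))
      ((pencil.π φ G d).fiberToSpecResidueField (genericPoint (PP k 1)))) :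
    ∃ j ∈ Finset.Icc 1 (min d n), d.choose j ∣ e := by
  have ht : Transcendental k φ :=
    RatFunc.transcendental_of_ne_C _ (ne_C_of_finrank_pos (hφ.symm ▸ hd))
  obtain ⟨ε, hε⟩ := exists_residueField_equiv (v := ![IntermediateField.AdjoinSimple.gen k φ, 1])
    ht rfl rfl
  obtain ⟨L, _, _, _, rfl, f, hf⟩ := (mem_pointDegrees_fiber_iff _ _ _).1 he
  exact exists_choose_dvd_finrank_of_equiv _ _ ε hε hd hφ hGal rfl f hf

theorem mem_pointDegrees (hd : 0 < d) (hn : 0 < n) (hφ : Module.finrank k⟮φ⟯ (RatFunc k) = d) :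
    d ∈ pointDegrees ((PP k 1).residueField (genericPoint (PP k 1)))
      ((pencil.π φ G d).fiberToSpecResidueField (genericPoint (PP k 1))) := by
  have ht : Transcendental k φ :=
    RatFunc.transcendental_of_ne_C _ (ne_C_of_finrank_pos (hφ.symm ▸ hd))
  obtain ⟨ε, hε⟩ := exists_residueField_equiv (v := ![IntermediateField.AdjoinSimple.gen k φ, 1])
    ht rfl rfl
  exact (mem_pointDegrees_fiber_iff _ _ _).2
    (exists_point_finrank_eq _ _ ε hε hd hn hφ rfl)

end genericFibre

end NormPencil

end

/-! ### Finite schemes over a field and degrees of multi-sections -/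

noncomputable section
namespace NormPencil

section finiteScheme

variable {K : Type u} [Field K] {F : Scheme.{u}} (s : F ⟶ Spec (CommRingCat.of K))

/-- The functions on a `K`-scheme form a `K`-algebra. -/
abbrev globalSectionsAlgebra : Algebra K Γ(F, ⊤) :=
  ((Scheme.ΓSpecIso (CommRingCat.of K)).inv ≫ s.appTop).hom.toAlgebra

theorem finite_globalSections (hs : IsFinite s) :
    letI := globalSectionsAlgebra s
    FiniteDimensional K Γ(F, ⊤) := by
  let _ := globalSectionsAlgebra s
  have h : ((Scheme.ΓSpecIso (CommRingCat.of K)).inv ≫ s.appTop).hom.Finite := by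
    rw [CommRingCat.hom_comp]
    exact s.finite_appTop.comp (RingHom.Finite.of_surjective _
      (ConcreteCategory.bijective_of_isIso (Scheme.ΓSpecIso (CommRingCat.of K)).inv).2)
  exact h

/-- The ring of functions is Artinian, so its prime quotients are fields; `F` is affine, so each of
them is the field of a point. -/
theorem finrank_quotient_mem_pointDegrees (hs : IsFinite s) (p : Ideal Γ(F, ⊤)) [hp : p.IsPrime] :
    letI := globalSectionsAlgebra s
    Module.finrank K (Γ(F, ⊤) ⧸ p) ∈ pointDegrees K s := by
  let _ := globalSectionsAlgebra s
  have := finite_globalSections s hs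
  have : IsAffine F := isAffine_of_isAffineHom s
  have : IsArtinianRing Γ(F, ⊤) := IsArtinianRing.of_finite K _
  have : p.IsMaximal := inferInstance
  let _ := Ideal.Quotient.field p
  refine ⟨Γ(F, ⊤) ⧸ p, inferInstance, inferInstance, inferInstance, rfl,
    Spec.map (CommRingCat.ofHom (Ideal.Quotient.mk p)) ≫ F.isoSpec.inv, ?_⟩
  have h : F.isoSpec.inv ≫ s =
      Spec.map ((Scheme.ΓSpecIso (CommRingCat.of K)).inv ≫ s.appTop) := by
    rw [← Scheme.isoSpec_inv_naturality, Spec.map_comp]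
    congr 1
    exact Scheme.isoSpec_Spec_inv _
  rw [Category.assoc, h, ← Spec.map_comp]
  rfl

theorem pointDegrees_subset {X : Scheme.{u}} (t : X ⟶ Spec (CommRingCat.of K)) (g : F ⟶ X)
    (hg : g ≫ t = s) : pointDegrees K s ⊆ pointDegrees K t := by
  rintro e ⟨L, _, _, h, he, x, hx⟩
  exact ⟨L, _, _, h, he, x ≫ g, by rw [Category.assoc, hg, hx]⟩

theorem finrank_globalSections_mem (hs : IsFinite s) {T : AddSubmonoid ℕ}
    (h : ∀ e ∈ pointDegrees K s, e ∈ T) :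
    letI := globalSectionsAlgebra s
    Module.finrank K Γ(F, ⊤) ∈ T := by
  let _ := globalSectionsAlgebra s
  have := finite_globalSections s hs
  exact finrank_mem_of_forall_quotient_mem T
    (fun p _ => h _ (finrank_quotient_mem_pointDegrees s hs p)) _

/-- With a single prime, all quotients in the filtration are the same residue field, and the
dimension is a multiple of its degree. -/
theorem exists_mem_pointDegrees_dvd_finrank (hs : IsFinite s) [Subsingleton F] [Nonempty F] :
    letI := globalSectionsAlgebra s
    ∃ e ∈ pointDegrees K s, e ∣ Module.finrank K Γ(F, ⊤) := by
  let _ := globalSectionsAlgebra s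
  have := finite_globalSections s hs
  have : IsAffine F := isAffine_of_isAffineHom s
  have : Subsingleton (PrimeSpectrum Γ(F, ⊤)) :=
    (show Function.Injective F.isoSpec.inv from
      F.isoSpec.inv.homeomorph.injective).subsingleton
  let z : PrimeSpectrum Γ(F, ⊤) := F.isoSpec.hom (Classical.arbitrary F)
  refine ⟨_, finrank_quotient_mem_pointDegrees s hs z.asIdeal, ?_⟩
  have := finrank_mem_of_forall_quotient_mem (K := K) (A := Γ(F, ⊤))
    (AddSubmonoid.multiples (Module.finrank K (Γ(F, ⊤) ⧸ z.asIdeal)))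
    (fun p hp => by
      have : (⟨p, hp⟩ : PrimeSpectrum Γ(F, ⊤)) = z := Subsingleton.elim _ _
      rw [← this]
      exact AddSubmonoid.mem_multiples _) Γ(F, ⊤)
  obtain ⟨m, hm⟩ := this
  exact ⟨m, hm.symm.trans ((smul_eq_mul ..).trans (mul_comm ..))⟩

theorem finrank_globalSections_ne_zero (hs : IsFinite s) [Nonempty F] :
    letI := globalSectionsAlgebra s
    Module.finrank K Γ(F, ⊤) ≠ 0 := by
  let _ := globalSectionsAlgebra s
  have := finite_globalSections s hs
  have : Nonempty (⊤ : F.Opens) := ⟨⟨Classical.arbitrary F, trivial⟩⟩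
  have : Nontrivial Γ(F, ⊤) := inferInstance
  exact Module.finrank_pos.ne'

end finiteScheme

section fibre

variable {Z B : Scheme.{u}} (ψ : Z ⟶ B)

theorem isFinite_fiberToSpecResidueField [IsFinite ψ] (b : B) :
    IsFinite (ψ.fiberToSpecResidueField b) :=
  inferInstanceAs (IsFinite (pullback.snd _ _))

theorem nonempty_fiber [Surjective ψ] (b : B) : Nonempty (ψ.fiber b) := by
  obtain ⟨z, hz⟩ := ψ.surjective b
  exact ⟨(ψ.fiberHomeo b).symm ⟨z, hz⟩⟩

/-- The generic point of `Z` lies in this fibre, which is discrete by finiteness. A neighbourhood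
isolating a point `x` of the fibre also contains the generic point of `Z`, so `x` is that point. -/
theorem subsingleton_fiber_genericPoint [IrreducibleSpace B] [IsFinite ψ] [Surjective ψ]
    [IrreducibleSpace Z] :
    Subsingleton (ψ.fiber (genericPoint B)) := by
  have hζ : ψ (genericPoint Z) = genericPoint B := by
    have h := (genericPoint_spec Z).image ψ.continuous
    rw [Set.image_univ, ψ.surjective.range_eq, closure_univ] at h
    exact h.eq (genericPoint_spec B)
  have : DiscreteTopology (ψ.fiber (genericPoint B)) := inferInstance
  have key (x : ψ.fiber (genericPoint B)) :
      ψ.fiberι (genericPoint B) x = genericPoint Z := by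
    obtain ⟨U, hU, hUx⟩ := (ψ.fiberι (genericPoint B)).isEmbedding.isOpen_iff.1
      (isOpen_discrete {x})
    have hmem : genericPoint Z ∈ U := (genericPoint_spec Z).mem_open_set_iff hU |>.2
      ⟨ψ.fiberι (genericPoint B) x, trivial, by
        have : x ∈ (ψ.fiberι (genericPoint B)) ⁻¹' U := hUx ▸ rfl
        exact this⟩
    obtain ⟨y, hy⟩ : genericPoint Z ∈ Set.range (ψ.fiberι (genericPoint B)) := by
      rw [Scheme.Hom.range_fiberι]; exact hζ
    have hyx : y ∈ ({x} : Set _) := by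
      rw [← hUx, Set.mem_preimage, hy]; exact hmem
    rw [← hy, Set.mem_singleton_iff.1 hyx]
  exact ⟨fun x y => (ψ.fiberι (genericPoint B)).isEmbedding.injective
    ((key x).trans (key y).symm)⟩

end fibre

section multisection

variable {Z X B : Scheme.{u}} {i : Z ⟶ X} {π : X ⟶ B}

theorem pointDegrees_fiber_comp_subset (b : B) :
    pointDegrees (B.residueField b) ((i ≫ π).fiberToSpecResidueField b) ⊆
      pointDegrees (B.residueField b) (π.fiberToSpecResidueField b) :=
  pointDegrees_subset _ _ (pullback.lift ((i ≫ π).fiberι b ≫ i)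
    ((i ≫ π).fiberToSpecResidueField b)
    (by rw [Category.assoc, Scheme.Hom.fiber_fac])) (pullback.lift_snd ..)

theorem IsMultisection.exists_dvd_genericDegree [IrreducibleSpace B] (h : IsMultisection i π)
    [IrreducibleSpace Z] :
    ∃ e ∈ pointDegrees (B.residueField (genericPoint B))
      (π.fiberToSpecResidueField (genericPoint B)), e ∣ genericDegree (i ≫ π) := by
  have := h.isFinite
  have := h.surjective
  have := subsingleton_fiber_genericPoint (i ≫ π)
  have := nonempty_fiber (i ≫ π) (genericPoint B)
  obtain ⟨e, he, hdvd⟩ := exists_mem_pointDegrees_dvd_finrank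
    ((i ≫ π).fiberToSpecResidueField (genericPoint B)) (isFinite_fiberToSpecResidueField _ _)
  exact ⟨e, pointDegrees_fiber_comp_subset _ he, hdvd⟩

theorem IsMultisection.genericDegree_mem [IrreducibleSpace B] (h : IsMultisection i π) {S : Set ℕ}
    (hS : ∀ e ∈ pointDegrees (B.residueField (genericPoint B))
      (π.fiberToSpecResidueField (genericPoint B)), e ∈ AddSubmonoid.closure S) :
    genericDegree (i ≫ π) ∈ AddSubsemigroup.closure S := by
  have := h.isFinite
  have := h.surjective
  have := nonempty_fiber (i ≫ π) (genericPoint B)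
  -- The value `0` is excluded because surjectivity makes the generic fibre nonempty.
  refine (eq_zero_or_mem_addSubsemigroup_closure (finrank_globalSections_mem
    ((i ≫ π).fiberToSpecResidueField (genericPoint B)) (isFinite_fiberToSpecResidueField _ _)
    fun e he => hS e (pointDegrees_fiber_comp_subset _ he))).resolve_left ?_
  exact finrank_globalSections_ne_zero _ (isFinite_fiberToSpecResidueField _ _)

end multisection

/-- Induction by Pascal's rule, one summand being at least `d - 1` and the other at least `1`; the
case `j = d - 1` is direct. -/
theorem le_choose_of_lt {d j : ℕ} (hj : 1 ≤ j) (hjd : j < d) : d ≤ d.choose j := by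
  induction d generalizing j with
  | zero => omega
  | succ m ih =>
    rcases (Nat.lt_succ_iff.1 hjd).eq_or_lt with rfl | hlt
    · rw [Nat.choose_succ_self_right]
    · obtain ⟨i, rfl⟩ := Nat.exists_eq_add_of_le' hj
      rw [Nat.choose_succ_succ']
      have h₁ := ih hj hlt
      have h₂ := Nat.choose_pos (show i ≤ m by omega)
      omega

end NormPencil

end

/-! ### The theorem -/

open NormPencil
theorem proposition2p1 {k : Type u} [Field k] (d n : ℕ) (hd : 0 < d) (hn : 0 < n)
    (φ : RatFunc k) (hφ : Module.finrank k⟮φ⟯ (RatFunc k) = d)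
    (hGal : HasSymmetricGaloisGroup φ d)
    (G : Module.Basis (Fin (n + 1)) k (Polynomial.degreeLT k (n + 1))) :
    (∀ (Z : Scheme.{u}) (i : Z ⟶ pencil φ G d), IsMultisection i (pencil.π φ G d) →
      IrreducibleSpace Z →
      ∃ j ∈ Finset.Icc 1 (min d n), d.choose j ∣ genericDegree (i ≫ pencil.π φ G d)) ∧
    (∀ (Z : Scheme.{u}) (i : Z ⟶ pencil φ G d), IsMultisection i (pencil.π φ G d) →
      genericDegree (i ≫ pencil.π φ G d) ∈
        AddSubsemigroup.closure {e | ∃ j ∈ Finset.Icc 1 (min d n), e = d.choose j}) ∧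
    (n < d →
      minimalDegree ((PP k 1).residueField (genericPoint (PP k 1)))
        ((pencil.π φ G d).fiberToSpecResidueField (genericPoint (PP k 1))) = d ∧
      (Finset.Icc 1 n).gcd (fun j => d.choose j) ∣
        index ((PP k 1).residueField (genericPoint (PP k 1)))
          ((pencil.π φ G d).fiberToSpecResidueField (genericPoint (PP k 1)))) := by
  refine ⟨fun Z i hi _ => ?_, fun Z i hi => ?_, fun hnd => ⟨?_, ?_⟩⟩
  · obtain ⟨e, he, hdvd⟩ := hi.exists_dvd_genericDegree
    obtain ⟨j, hj, hje⟩ := exists_choose_dvd_of_mem_pointDegrees G hd hφ hGal he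
    exact ⟨j, hj, hje.trans hdvd⟩
  · refine hi.genericDegree_mem fun e he => ?_
    obtain ⟨j, hj, m, rfl⟩ := exists_choose_dvd_of_mem_pointDegrees G hd hφ hGal he
    rw [mul_comm, ← smul_eq_mul]
    refine AddSubmonoid.nsmul_mem _ (AddSubmonoid.subset_closure ?_) m
    exact ⟨j, hj, rfl⟩
  · have hmem := mem_pointDegrees G hd hn hφ
    refine le_antisymm (Nat.sInf_le hmem)
      (le_csInf (s := pointDegrees _ _) ⟨d, hmem⟩ fun e he => ?_)
    obtain ⟨j, hj, hje⟩ := exists_choose_dvd_of_mem_pointDegrees G hd hφ hGal he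
    -- Unpacking `e` as the degree of a finite extension shows that it is positive, so the
    -- divisibility gives an inequality.
    obtain ⟨L, _, _, _, rfl, -⟩ := he
    rw [Finset.mem_Icc] at hj
    refine le_trans ?_ (Nat.le_of_dvd Module.finrank_pos hje)
    exact le_choose_of_lt hj.1 ((hj.2.trans (min_le_right d n)).trans_lt hnd)
  · refine Nat.dvd_setGcd_iff.2 fun e he => ?_
    obtain ⟨j, hj, hje⟩ := exists_choose_dvd_of_mem_pointDegrees G hd hφ hGal he
    rw [min_eq_right hnd.le] at hj
    exact (Finset.gcd_dvd hj).trans hje
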